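/- Let $(\Omega,\Sigma,P)$ be a probability space and let $\Theta$ be a real random variable on it with $P(\Theta>0)=1$. Let $N=(N_t)_{t\ge 0}$ be a counting process: the $N_t$ are random variables with values in $\mathbb N_0=\{0,1,2,\dots\}$ (so there is no explosion) such that, for every $\omega\in\Omega$, $N_0=0$, $N_t=\inf_{s>t}N_s$ for all $t\ge 0$, $\sup_{s<t}N_s\le N_t\le \sup_{s<t}N_s+1$ for all $t>0$, and $\sup_{t\ge0}N_t=\infty$. Let $T_n=\inf\{t\ge 0: N_t=n\}$ for $n\ge 0$, and let $W=(W_n)_{n\ge1}$ with $W_n=T_n-T_{n-1}$ be the interarrival process. Let $X=(X_n)_{n\ge1}$ be a sequence of (strictly) positive real random variables. The pair $(N,X)$ is called a risk process if $X$ is i.i.d. under $P$ and the processes $N$ and $X$ are independent under $P$. The aggregate process $S=(S_t)_{t\ge0}$ induced by $(N,X)$ is $S_t=\sum_{k=1}^{N_t}X_k$. A counting process $N$ is a $P$-mixed Poisson process with parameter $\Theta$ if, conditionally given $\sigma(\Theta)$, it has independent and stationary increments under $P$, and for each $t>0$ the conditional distribution of $N_t$ given $\Theta$ is, almost surely, the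 Poisson law with parameter $t\Theta$. A process $S$ is a $P$-$\mathrm{CMPP}(\Theta,\nu)$ (compound mixed Poisson process) if it is the aggregate process induced by a risk process $(N,X)$ such that $N$ is a $P$-mixed Poisson process with parameter $\Theta$ and $X_1$ has law $\nu$. **Theorem.** Let $S$ be the aggregate process induced by a risk process $(N,X)$, and assume that * (a1) the processes $W$ and $X$ are conditionally independent of each other given $\sigma(\Theta)$ under $P$; * (a2) the random variable $\Theta$ and the sequence $X$ are independent under $P$; * $X_1$ and $\Theta$ are $P$-integrable. Let $\mathcal F_t=\sigma\bigl(\sigma(S_u:0\le u\le t)\cup\sigma(\Theta)\bigr)$ for $t\ge0$. Then the following are equivalent: 1. $S$ is a $P$-$\mathrm{CMPP}(\Theta,P_{X_1})$, where $P_{X_1}$ is the law of $X_1$ under $P$; 2. the process $\bigl(S_t-t\,\Theta\,\mathbb E_P[X_1]\bigr)_{t\ge0}$ is a martingale in $\mathcal L^1(P)$ for the filtration $(\mathcal F_t)_{t\ge0}$. -/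

import Mathlib

open MeasureTheory ProbabilityTheory
open scoped NNReal

noncomputable section

namespace CMPP

variable {Ω : Type*} [mΩ : MeasurableSpace Ω]

/-- A counting process `N = (N_t)_{t ≥ 0}` (empty exceptional set, no explosion): random variables
with values in `{0, 1, 2, …}`, starting at `0`, with `N_t = inf_{s > t} N_s`, with
`N_t ≤ sup_{s < t} N_s + 1` (for integer values the supremum over `s < t` of a bounded family is
attained), and with `sup_t N_t = ∞`. -/
structure IsCountingProcess (N : ℝ≥0 → Ω → ℕ) : Prop where
  measurable : ∀ t, Measurable (N t)
  zero : ∀ ω, N 0 ω = 0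
  isGLB : ∀ t ω, IsGLB ((fun s => N s ω) '' Set.Ioi t) (N t ω)
  jump_le_one : ∀ t, 0 < t → ∀ ω, ∃ s < t, N t ω ≤ N s ω + 1
  unbounded : ∀ n ω, ∃ t, n ≤ N t ω

/-- The arrival time `T_n = inf {t ≥ 0 : N_t = n}`. -/
def arrivalTime (N : ℝ≥0 → Ω → ℕ) (n : ℕ) (ω : Ω) : ℝ≥0 := sInf {t | N t ω = n}

/-- The interarrival times; `interarrival N n` is `W_{n+1} = T_{n+1} - T_n`. -/
def interarrival (N : ℝ≥0 → Ω → ℕ) (n : ℕ) (ω : Ω) : ℝ :=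
  (arrivalTime N (n + 1) ω : ℝ) - arrivalTime N n ω

/-- The aggregate process `S_t = X_1 + … + X_{N_t}`. The claim sizes are indexed from `0` in the
code: `X n` is the `(n+1)`-st claim size `X_{n+1}`. -/
def aggregate (N : ℝ≥0 → Ω → ℕ) (X : ℕ → Ω → ℝ) (t : ℝ≥0) (ω : Ω) : ℝ :=
  ∑ k ∈ Finset.range (N t ω), X k ω

/-- `(N, X)` is a risk process under `P`: `N` is a counting process, the claim sizes `X` are
positive random variables, i.i.d. under `P`, and the processes `N` and `X` are independent. -/
structure IsRiskProcess (N : ℝ≥0 → Ω → ℕ) (X : ℕ → Ω → ℝ) (P : Measure Ω) : Prop where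
  counting : IsCountingProcess N
  measurable_size : ∀ n, Measurable (X n)
  size_pos : ∀ n ω, 0 < X n ω
  size_indep : iIndepFun X P
  size_identDistrib : ∀ n, IdentDistrib (X n) (X 0) P P
  indep : IndepFun (fun ω t => N t ω) (fun ω n => X n ω) P

/-- Conditional independence, given the σ-algebra `𝒢`, of two σ-algebras:
`P(A ∩ B | 𝒢) = P(A | 𝒢) P(B | 𝒢)` almost surely. (Stated on an arbitrary probability space.) -/
def CondIndepPair (P : Measure Ω) (𝒢 𝒜 ℬ : MeasurableSpace Ω) : Prop :=
  ∀ A B : Set Ω, MeasurableSet[𝒜] A → MeasurableSet[ℬ] B →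
    P⟦A ∩ B|𝒢⟧ =ᵐ[P] fun ω => (P⟦A|𝒢⟧) ω * (P⟦B|𝒢⟧) ω

/-- Conditional independence, given the σ-algebra `𝒢`, of a family of σ-algebras:
`P(⋂_{i ∈ s} A_i | 𝒢) = ∏_{i ∈ s} P(A_i | 𝒢)` almost surely, for every finite set `s` of
indices. -/
def CondIndepFamily {ι : Type*} (P : Measure Ω) (𝒢 : MeasurableSpace Ω)
    (𝒜 : ι → MeasurableSpace Ω) : Prop :=
  ∀ (s : Finset ι) (A : ι → Set Ω), (∀ i ∈ s, MeasurableSet[𝒜 i] (A i)) →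
    P⟦⋂ i ∈ s, A i|𝒢⟧ =ᵐ[P] fun ω => ∏ i ∈ s, (P⟦A i|𝒢⟧) ω

/-- The σ-algebra generated by the random variable `Θ`. -/
abbrev sigmaOf (Θ : Ω → ℝ) : MeasurableSpace Ω := MeasurableSpace.comap Θ inferInstance

/-- Condition (a1): the processes `W` (interarrival times of `N`) and `X` are conditionally
independent of each other given `Θ`. -/
def CondA1 (N : ℝ≥0 → Ω → ℕ) (X : ℕ → Ω → ℝ) (Θ : Ω → ℝ) (P : Measure Ω) : Prop :=
  CondIndepPair P (sigmaOf Θ)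
    (MeasurableSpace.comap (fun ω n => interarrival N n ω) inferInstance)
    (MeasurableSpace.comap (fun ω n => X n ω) inferInstance)

/-- Condition (a2): the random variable `Θ` and the sequence `X` are independent. -/
def CondA2 (X : ℕ → Ω → ℝ) (Θ : Ω → ℝ) (P : Measure Ω) : Prop :=
  IndepFun Θ (fun ω n => X n ω) P

/-- Conditionally independent increments given `Θ`: for all `t_0 < t_1 < … < t_m` the increments
`Z_{t_j} - Z_{t_{j-1}}` are conditionally independent given `σ(Θ)`. -/
def HasCondIndepIncrements (Z : ℝ≥0 → Ω → ℝ) (Θ : Ω → ℝ) (P : Measure Ω) : Prop :=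
  ∀ (m : ℕ) (t : Fin (m + 1) → ℝ≥0), StrictMono t →
    CondIndepFamily P (sigmaOf Θ)
      (fun j : Fin m =>
        MeasurableSpace.comap (fun ω => Z (t j.succ) ω - Z (t j.castSucc) ω) inferInstance)

/-- Conditionally stationary increments given `Θ`: for all `t_0 < t_1 < … < t_m` and `h ≥ 0` the
vectors of the increments over the intervals `(t_{j-1} + h, t_j + h]` and over the intervals
`(t_{j-1}, t_j]` are conditionally identically distributed over `Θ`. -/
def HasCondStationaryIncrements (Z : ℝ≥0 → Ω → ℝ) (Θ : Ω → ℝ) (P : Measure Ω) : Prop :=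
  ∀ (m : ℕ) (t : Fin (m + 1) → ℝ≥0) (h : ℝ≥0), StrictMono t →
    ∀ (F : Set Ω) (B : Set (Fin m → ℝ)), MeasurableSet[sigmaOf Θ] F → MeasurableSet B →
      P (F ∩ {ω | (fun j : Fin m => Z (t j.succ + h) ω - Z (t j.castSucc + h) ω) ∈ B}) =
        P (F ∩ {ω | (fun j : Fin m => Z (t j.succ) ω - Z (t j.castSucc) ω) ∈ B})

/-- `N` is a mixed Poisson process with parameter `Θ` under `P`: it has conditionally stationary
independent increments given `Θ`, and for every `t > 0` the conditional distribution of `N_t`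
given `Θ` is the Poisson law with parameter `tΘ`, almost surely. (`Θ` is almost surely positive
wherever this is used; `Real.toNNReal` only makes the parameter meaningful on the null set where
it is not.) -/
structure IsMPP (N : ℝ≥0 → Ω → ℕ) (Θ : Ω → ℝ) (P : Measure Ω) [IsFiniteMeasure P] : Prop where
  condIndepIncrements : HasCondIndepIncrements (fun t ω => (N t ω : ℝ)) Θ P
  condStationaryIncrements : HasCondStationaryIncrements (fun t ω => (N t ω : ℝ)) Θ P
  poisson : ∀ t : ℝ≥0, 0 < t →
    ∀ᵐ ω ∂P, condDistrib (N t) Θ P (Θ ω) = poissonMeasure (t * (Θ ω).toNNReal)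

/-- `S` is a compound mixed Poisson process with parameters `Θ` and `ν` under `P`: it is the
aggregate process induced by a risk process `(N, X)` such that `N` is a mixed Poisson process with
parameter `Θ` and `X_1` has the law `ν`. -/
def IsCMPP (S : ℝ≥0 → Ω → ℝ) (Θ : Ω → ℝ) (ν : Measure ℝ) (P : Measure Ω) [IsFiniteMeasure P] :
    Prop :=
  ∃ (N : ℝ≥0 → Ω → ℕ) (X : ℕ → Ω → ℝ),
    IsRiskProcess N X P ∧ S = aggregate N X ∧ P.map (X 0) = ν ∧ IsMPP N Θ P

theorem IsRiskProcess.measurable_aggregate {N : ℝ≥0 → Ω → ℕ} {X : ℕ → Ω → ℝ} {P : Measure Ω}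
    (h : IsRiskProcess N X P) (t : ℝ≥0) : Measurable (aggregate N X t) := by
  have h1 : Measurable (fun p : ℕ × Ω => ∑ k ∈ Finset.range p.1, X k p.2) :=
    measurable_from_prod_countable_right fun n =>
      Finset.measurable_sum (Finset.range n) fun k _ => h.measurable_size k
  exact h1.comp ((h.counting.measurable t).prodMk measurable_id)

/-- The canonical filtration of `S` and `Θ`: `ℱ_t = σ(σ(S_u : u ≤ t) ∪ σ(Θ))`. -/
def canonicalFiltration (S : ℝ≥0 → Ω → ℝ) (Θ : Ω → ℝ) (hS : ∀ t, Measurable (S t))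
    (hΘ : Measurable Θ) : Filtration ℝ≥0 mΩ where
  seq t := (⨆ u ≤ t, MeasurableSpace.comap (S u) inferInstance) ⊔ sigmaOf Θ
  mono' _ _ hst := sup_le_sup_right (biSup_mono fun _ hu => hu.trans hst) _
  le' _ := sup_le (iSup₂_le fun u _ => (hS u).comap_le) hΘ.comap_le

end CMPP

end

/-! Both statements are equivalent to one about `N` alone: `HasIntensity`, which says that `N_t -
tΘ` has balanced increments on the history of `N` and `Θ`.

Compound side. The claims are strictly positive, so `S` increases exactly when `N` does. Hence `S`
determines `N`, and any representation of `S` as a CMPP uses the given counting process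
(`IsRiskProcess.isCMPP_iff`).

Martingale side. By (a1) and (a2) the claim sequence is independent of the pair `(N, Θ)`. On the
event that at most `k` claims have arrived by time `s`, the past of `S` involves only `N`, `Θ` and
the first `k` claims, which are independent of the next one. Summing over the claims that arrive in
`(s, t]` gives a Wald identity (`IsRiskProcess.setLIntegral_aggregate_sub`): expected increments of
`S` are those of `N` times the positive finite mean claim. Cancelling this mean relates the
martingale property to the intensity (`IsRiskProcess.hasIntensity_iff`,
`IsRiskProcess.martingale_iff`).

The core is Watanabe's theorem: the intensity forces conditionally Poisson increments. On a fine
partition, each factor `z ^ (N_b - N_a)` is exchanged for the Poisson generating function `exp(-(1 -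
z)(b - a)Θ)`. First-order terms cancel by the intensity. The accumulated second-order error vanishes
by dominated convergence, because a path has finitely many jumps, all of size one, on a bounded
interval (`HasIntensity.setIntegral_pow`). Generating functions then identify the law.

`HasPoissonIncrements` is the intermediate form: it gives the intensity by taking means, and it is
matched with the definition of a mixed Poisson process through product formulas and a π-system
argument. -/

open scoped ENNReal

namespace CMPP

/-! ### Paths of counting processes -/

namespace IsCountingProcess

variable {Ω : Type*} [mΩ : MeasurableSpace Ω] {N : ℝ≥0 → Ω → ℕ}

lemma mono (h : IsCountingProcess N) (ω : Ω) : Monotone fun t => N t ω := by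
  intro s t hst
  rcases hst.eq_or_lt with rfl | hlt
  · exact le_rfl
  · exact (h.isGLB s ω).1 ⟨t, hlt, rfl⟩

/-- Right-continuity in discrete form: an infimum of natural numbers is attained. -/
lemma exists_gt_eq (h : IsCountingProcess N) (t : ℝ≥0) (ω : Ω) : ∃ s, t < s ∧ N s ω = N t ω := by
  have hne : ((fun s => N s ω) '' Set.Ioi t).Nonempty := ⟨_, t + 1, by simp, rfl⟩
  obtain ⟨s, hs, hs'⟩ := Nat.sInf_mem hne
  refine ⟨s, hs, ?_⟩
  have hs'' : N s ω = sInf ((fun s => N s ω) '' Set.Ioi t) := hs'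
  rw [hs'']
  exact (isGLB_csInf hne).unique (h.isGLB t ω)

/-- The process reaches level `n` at a first time, and takes the value `n` there. -/
lemma exists_first (h : IsCountingProcess N) (n : ℕ) (ω : Ω) :
    ∃ T, N T ω = n ∧ ∀ t, T ≤ t ↔ n ≤ N t ω := by
  set A : Set ℝ≥0 := {t | n ≤ N t ω} with hA
  have hne : A.Nonempty := h.unbounded n ω
  have hmem : n ≤ N (sInf A) ω := by
    obtain ⟨s, hs, hsN⟩ := h.exists_gt_eq (sInf A) ω
    obtain ⟨t, ht, hts⟩ := exists_lt_of_csInf_lt hne hs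
    rw [← hsN]
    exact le_trans ht (h.mono ω hts.le)
  have hiff : ∀ t, sInf A ≤ t ↔ n ≤ N t ω :=
    fun t => ⟨fun ht => hmem.trans (h.mono ω ht), fun ht => csInf_le' ht⟩
  refine ⟨sInf A, le_antisymm ?_ hmem, hiff⟩
  rcases eq_or_ne (sInf A) 0 with h0 | h0
  · rw [h0, h.zero]; exact Nat.zero_le _
  -- Strictly before the first passage the level is below `n`, and a jump adds at most one, so `n`
  -- is not overshot.
  · obtain ⟨s, hs, hsN⟩ := h.jump_le_one _ (pos_iff_ne_zero.2 h0) ω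
    have : ¬ n ≤ N s ω := fun hc => absurd ((hiff s).2 hc) (not_le.2 hs)
    omega

lemma arrivalTime_le_iff (h : IsCountingProcess N) (n : ℕ) (ω : Ω) (t : ℝ≥0) :
    arrivalTime N n ω ≤ t ↔ n ≤ N t ω := by
  obtain ⟨T, hT, hiff⟩ := h.exists_first n ω
  have : arrivalTime N n ω = T :=
    le_antisymm (csInf_le' hT) (le_csInf ⟨T, hT⟩ fun s hs => (hiff s).2 (le_of_eq hs.symm))
  rw [this, hiff]

lemma apply_arrivalTime (h : IsCountingProcess N) (n : ℕ) (ω : Ω) :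
    N (arrivalTime N n ω) ω = n := by
  obtain ⟨T, hT, hiff⟩ := h.exists_first n ω
  have : arrivalTime N n ω = T :=
    le_antisymm (csInf_le' hT) (le_csInf ⟨T, hT⟩ fun s hs => (hiff s).2 (le_of_eq hs.symm))
  rw [this, hT]

lemma arrivalTime_zero (h : IsCountingProcess N) (ω : Ω) : arrivalTime N 0 ω = 0 :=
  le_antisymm ((h.arrivalTime_le_iff 0 ω 0).2 (Nat.zero_le _)) zero_le

lemma arrivalTime_lt_succ (h : IsCountingProcess N) (n : ℕ) (ω : Ω) :
    arrivalTime N n ω < arrivalTime N (n + 1) ω := by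
  by_contra hc
  have := (h.arrivalTime_le_iff (n + 1) ω _).1 (not_lt.1 hc)
  rw [h.apply_arrivalTime] at this
  omega

lemma arrivalTime_eq_sum (h : IsCountingProcess N) (n : ℕ) (ω : Ω) :
    (arrivalTime N n ω : ℝ) = ∑ i ∈ Finset.range n, interarrival N i ω := by
  simp [interarrival, Finset.sum_range_sub (fun i => (arrivalTime N i ω : ℝ)),
    h.arrivalTime_zero]

/-- The counting process is a function of its interarrival times. -/
lemma measurable_comap_interarrival (h : IsCountingProcess N) (t : ℝ≥0) :
    Measurable[MeasurableSpace.comap (fun ω n => interarrival N n ω) inferInstance] (N t) := by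
  have hN : ∀ n, N t ⁻¹' Set.Ici n = {ω | ∑ i ∈ Finset.range n, interarrival N i ω ≤ t} := by
    intro n
    ext ω
    rw [Set.mem_preimage, Set.mem_Ici, ← h.arrivalTime_le_iff, Set.mem_ofPred_eq,
      ← h.arrivalTime_eq_sum, NNReal.coe_le_coe]
  generalize interarrival N = W at hN
  let m : MeasurableSpace Ω := MeasurableSpace.comap (fun ω n => W n ω) inferInstance
  have hW : ∀ n, Measurable[m] (W n) := fun n =>
    (measurable_pi_apply n).comp (comap_measurable (fun ω n => W n ω))
  refine measurable_of_Ici fun n => ?_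
  rw [hN]
  exact measurableSet_le (Finset.measurable_sum _ fun i _ => hW i) measurable_const

/-- On every path the jump times up to `t` are separated by a positive distance. -/
lemma exists_pos_forall_le_add_one (h : IsCountingProcess N) (t : ℝ≥0) (ω : Ω) :
    ∃ ε : ℝ≥0, 0 < ε ∧ ∀ a b, a ≤ b → b ≤ t → b < a + ε → N b ω ≤ N a ω + 1 := by
  obtain ⟨ε, hε, hε'⟩ : ∃ ε : ℝ≥0, 0 < ε ∧ ∀ k ∈ Finset.range (N t ω + 1),
      arrivalTime N k ω + ε ≤ arrivalTime N (k + 1) ω := by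
    -- Finitely many gaps matter up to time `t`; the induction takes the minimum of their lengths.
    generalize N t ω + 1 = K
    induction K with
    | zero => exact ⟨1, one_pos, by simp⟩
    | succ K ih =>
      obtain ⟨ε, hε, hK⟩ := ih
      refine ⟨min ε (arrivalTime N (K + 1) ω - arrivalTime N K ω),
        lt_min hε (tsub_pos_of_lt (h.arrivalTime_lt_succ K ω)), fun k hk => ?_⟩
      rcases (Nat.lt_succ_iff_lt_or_eq).1 (Finset.mem_range.1 hk) with hk | rfl
      · exact (by gcongr; exact min_le_left _ _ : _ ≤ _).trans (hK k (Finset.mem_range.2 hk))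
      · calc _ ≤ arrivalTime N k ω + (arrivalTime N (k + 1) ω - arrivalTime N k ω) := by
              gcongr; exact min_le_right _ _
          _ = _ := add_tsub_cancel_of_le (h.arrivalTime_lt_succ k ω).le
  refine ⟨ε, hε, fun a b hab hbt hb => ?_⟩
  by_contra hc
  -- If `N` grew by two or more, two consecutive arrivals would lie in `(a, b]`, closer together
  -- than `ε`.
  have h1 : a < arrivalTime N (N a ω + 1) ω := by
    rw [← not_le, h.arrivalTime_le_iff]; omega
  have h2 : arrivalTime N (N a ω + 1 + 1) ω ≤ b := (h.arrivalTime_le_iff _ ω b).2 (by omega)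
  have h3 := h.mono ω hbt
  have h4 := hε' (N a ω + 1) (Finset.mem_range.2 (by dsimp only at h3; omega))
  have : a + ε ≤ b := (by gcongr : a + ε ≤ _ + ε).trans (h4.trans h2)
  exact absurd hb (not_lt.2 this)

end IsCountingProcess

/-! ### The aggregate process determines the counting process -/

section Aggregate

variable {Ω : Type*} [mΩ : MeasurableSpace Ω] {N N' : ℝ≥0 → Ω → ℕ} {X X' : ℕ → Ω → ℝ}

lemma strictMono_sum_range {x : ℕ → ℝ} (hx : ∀ n, 0 < x n) :
    StrictMono fun n => ∑ k ∈ Finset.range n, x k :=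
  strictMono_nat_of_lt_succ fun n => by simp [Finset.sum_range_succ, hx n]

lemma aggregate_lt_aggregate_iff (hX : ∀ n ω, 0 < X n ω) (s t : ℝ≥0) (ω : Ω) :
    aggregate N X s ω < aggregate N X t ω ↔ N s ω < N t ω :=
  (strictMono_sum_range fun n => hX n ω).lt_iff_lt

/-- Induction on the level: after the `k`-th arrival of `N`, where `N'` is at least `k`, any further
growth of `N` makes the common aggregate process grow, and hence `N'` as well. -/
lemma IsCountingProcess.le_of_aggregate_eq (hN : IsCountingProcess N)
    (hX : ∀ n ω, 0 < X n ω) (hX' : ∀ n ω, 0 < X' n ω) (h : aggregate N X = aggregate N' X')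
    (t : ℝ≥0) (ω : Ω) : N t ω ≤ N' t ω := by
  suffices ∀ k t, k ≤ N t ω → k ≤ N' t ω from this _ t le_rfl
  intro k
  induction k with
  | zero => simp
  | succ k ih =>
    intro t ht
    have h1 : N (arrivalTime N k ω) ω < N t ω := by rw [hN.apply_arrivalTime]; omega
    have h2 := ih _ (hN.apply_arrivalTime k ω).ge
    rw [← aggregate_lt_aggregate_iff hX, h, aggregate_lt_aggregate_iff hX'] at h1
    omega

/-- The aggregate process determines the counting process. -/
lemma IsCountingProcess.eq_of_aggregate_eq (hN : IsCountingProcess N)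
    (hN' : IsCountingProcess N') (hX : ∀ n ω, 0 < X n ω) (hX' : ∀ n ω, 0 < X' n ω)
    (h : aggregate N X = aggregate N' X') : N = N' := by
  funext t ω
  exact le_antisymm (hN.le_of_aggregate_eq hX hX' h t ω)
    (hN'.le_of_aggregate_eq hX' hX h.symm t ω)

end Aggregate

/-- The counting process up to time `t` is observable from the aggregate process up to `t`. -/
lemma IsCountingProcess.measurable_of_aggregate {Ω : Type*} {m : MeasurableSpace Ω}
    [mΩ : MeasurableSpace Ω] {N : ℝ≥0 → Ω → ℕ} {X : ℕ → Ω → ℝ} (hN : IsCountingProcess N)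
    (hX : ∀ n ω, 0 < X n ω) {S : ℝ≥0 → Ω → ℝ} (hS : S = aggregate N X) (t : ℝ≥0)
    (hm : ∀ u ≤ t, Measurable[m] (S u)) : Measurable[m] (N t) := by
  have hlt : ∀ s t ω, S s ω < S t ω ↔ N s ω < N t ω := fun s t ω => by
    rw [hS, aggregate_lt_aggregate_iff hX]
  obtain ⟨D, hDc, hDd⟩ := TopologicalSpace.exists_countable_dense ℝ≥0
  suffices ∀ n, ∀ u ≤ t, MeasurableSet[m] {ω | n ≤ N u ω} from
    measurable_of_Ici fun n => this n t le_rfl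
  intro n
  induction n with
  | zero => intro u _; simp
  | succ n ih =>
    intro u hu
    -- Level `n + 1` is reached by `u` exactly when `S` grows between some earlier `s` with `N_s ≥
    -- n` and `u`. Such an `s` may be taken in the countable dense set, strictly between the
    -- arrivals `T_n` and `T_{n+1}`.
    have : {ω | n + 1 ≤ N u ω} = ⋃ s ∈ D ∩ Set.Iio u,
        ({ω | n ≤ N s ω} ∩ {ω | S s ω < S u ω}) := by
      ext ω
      simp only [Set.mem_ofPred_eq, Set.mem_iUnion, Set.mem_inter_iff, Set.mem_Iio, hlt, exists_prop]
      constructor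
      · intro h
        obtain ⟨T, hT, hTle⟩ := hN.exists_first n ω
        obtain ⟨T', -, hTle'⟩ := hN.exists_first (n + 1) ω
        have hTT' : T < T' := by
          rw [← not_le, hTle', hT]; omega
        obtain ⟨s, hsD, hs1, hs2⟩ := hDd.exists_between hTT'
        refine ⟨s, ⟨hsD, hs2.trans_le ((hTle' u).2 h)⟩, (hTle s).1 hs1.le, ?_⟩
        have : ¬ n + 1 ≤ N s ω := by
          rw [← hTle']; exact not_le.2 hs2
        omega
      · rintro ⟨s, _, h1, h2⟩
        omega
    rw [this]
    refine MeasurableSet.biUnion (hDc.mono Set.inter_subset_left) fun s hs => ?_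
    have hsu : s ≤ t := (le_of_lt hs.2).trans hu
    exact (ih s hsu).inter (measurableSet_lt (hm s hsu) (hm u hu))

/-! ### Uniqueness of measures and independence of joins -/

section Measure

variable {Ω : Type*}

/-- The measures with densities `f` and `g` have the same restriction to `m`, and integrating an
`m`-measurable `Y` only sees that restriction. -/
lemma lintegral_mul_eq_of_forall_setLIntegral_eq {m mΩ : MeasurableSpace Ω} {P : Measure Ω}
    (hm : m ≤ mΩ) {f g Y : Ω → ℝ≥0∞} (hf : Measurable f) (hg : Measurable g)
    (h : ∀ A, MeasurableSet[m] A → ∫⁻ ω in A, f ω ∂P = ∫⁻ ω in A, g ω ∂P)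
    (hY : Measurable[m] Y) : ∫⁻ ω, Y ω * f ω ∂P = ∫⁻ ω, Y ω * g ω ∂P := by
  have htrim : (P.withDensity f).trim hm = (P.withDensity g).trim hm := by
    refine @Measure.ext _ m _ _ fun A hA => ?_
    rw [trim_measurableSet_eq hm hA, trim_measurableSet_eq hm hA, withDensity_apply _ (hm A hA),
      withDensity_apply _ (hm A hA), h A hA]
  have hY' : Measurable Y := hY.mono hm le_rfl
  simp_rw [mul_comm (Y _)]
  have hd : ∀ {k : Ω → ℝ≥0∞}, Measurable k →
      ∫⁻ ω, k ω * Y ω ∂P = ∫⁻ ω, Y ω ∂((P.withDensity k).trim hm) := fun hk => by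
    rw [lintegral_trim hm hY, lintegral_withDensity_eq_lintegral_mul _ hk hY']
    rfl
  rw [hd hf, hd hg, htrim]

/-- Two finite measures that agree on the intersections of the members of a π-system generating
`m₁` with the members of `m₂` agree on `m₁ ⊔ m₂`. -/
lemma measure_eq_on_sup {m₁ m₂ mΩ : MeasurableSpace Ω} {μ ν : Measure Ω} [IsFiniteMeasure μ]
    (C : Set (Set Ω)) (hC : IsPiSystem C) (hm₁ : m₁ = MeasurableSpace.generateFrom C)
    (h₁ : m₁ ≤ mΩ) (h₂ : m₂ ≤ mΩ) (h : ∀ B, MeasurableSet[m₂] B → μ B = ν B)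
    (hCB : ∀ A ∈ C, ∀ B, MeasurableSet[m₂] B → μ (A ∩ B) = ν (A ∩ B)) {E : Set Ω}
    (hE : MeasurableSet[m₁ ⊔ m₂] E) : μ E = ν E := by
  -- Adding `univ` to `C` puts the members of `m₂` themselves into the π-system.
  set D : Set (Set Ω) := {E | ∃ A ∈ insert Set.univ C, ∃ B, MeasurableSet[m₂] B ∧ A ∩ B = E}
  have hgen : m₁ ⊔ m₂ = MeasurableSpace.generateFrom D := by
    refine le_antisymm (sup_le ?_ ?_) (MeasurableSpace.generateFrom_le ?_)
    · rw [hm₁]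
      refine MeasurableSpace.generateFrom_le fun A hA => ?_
      exact MeasurableSpace.measurableSet_generateFrom
        ⟨A, Set.mem_insert_of_mem _ hA, Set.univ, MeasurableSet.univ, Set.inter_univ A⟩
    · intro B hB
      exact MeasurableSpace.measurableSet_generateFrom
        ⟨Set.univ, Set.mem_insert _ _, B, hB, Set.univ_inter B⟩
    · rintro _ ⟨A, hA, B, hB, rfl⟩
      refine MeasurableSet.inter ((le_sup_left : m₁ ≤ m₁ ⊔ m₂) A ?_)
        ((le_sup_right : m₂ ≤ m₁ ⊔ m₂) B hB)
      rcases hA with rfl | hA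
      · exact MeasurableSet.univ
      · rw [hm₁]; exact MeasurableSpace.measurableSet_generateFrom hA
  have hpi : IsPiSystem D := by
    rintro _ ⟨A, hA, B, hB, rfl⟩ _ ⟨A', hA', B', hB', rfl⟩ hne
    rw [Set.inter_inter_inter_comm] at hne ⊢
    exact ⟨A ∩ A', hC.insert_univ A hA A' hA' (hne.mono Set.inter_subset_left), B ∩ B',
      hB.inter hB', rfl⟩
  refine ext_on_measurableSpace_of_generate_finite mΩ D ?_ (sup_le h₁ h₂) hgen hpi
    (h _ MeasurableSet.univ) hE
  rintro _ ⟨A, rfl | hA, B, hB, rfl⟩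
  · rw [Set.univ_inter, h B hB]
  · exact hCB A hA B hB

/-- For fixed `C`, the finite measures `P(· ∩ C)` and `P(C) P` agree on the sets `A ∩ B`, hence on
the join. -/
lemma indep_sup_left_of_forall {m₁ m₂ m₃ mΩ : MeasurableSpace Ω} {P : Measure Ω}
    [IsProbabilityMeasure P] (h₁ : m₁ ≤ mΩ) (h₂ : m₂ ≤ mΩ) (h₃ : m₃ ≤ mΩ)
    (h : ∀ A B C, MeasurableSet[m₁] A → MeasurableSet[m₂] B → MeasurableSet[m₃] C →
      P (A ∩ B ∩ C) = P (A ∩ B) * P C) : Indep (m₁ ⊔ m₂) m₃ P := by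
  rw [Indep_iff]
  intro E C hE hC
  have hCm := h₃ C hC
  have := measure_eq_on_sup (μ := P.restrict C) (ν := P C • P) {A | MeasurableSet[m₁] A}
    (@MeasurableSpace.isPiSystem_measurableSet _ m₁)
    (@MeasurableSpace.generateFrom_measurableSet _ m₁).symm h₁ h₂
    (fun B hB => ?_) (fun A hA B hB => ?_) hE
  · rwa [Measure.restrict_apply' hCm, Measure.smul_apply, smul_eq_mul, mul_comm] at this
  · have := h Set.univ B C MeasurableSet.univ hB hC
    rw [Set.univ_inter] at this
    rw [Measure.restrict_apply' hCm, Measure.smul_apply, smul_eq_mul, mul_comm, this]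
  · rw [Measure.restrict_apply' hCm, Measure.smul_apply, smul_eq_mul, mul_comm, h A B C hA hB hC]

lemma indep_sup_left {m₁ m₂ m₃ mΩ : MeasurableSpace Ω} {P : Measure Ω} [IsProbabilityMeasure P]
    (h₁ : m₁ ≤ mΩ) (h₂ : m₂ ≤ mΩ) (h₃ : m₃ ≤ mΩ) (h : Indep m₁ (m₂ ⊔ m₃) P)
    (h' : Indep m₂ m₃ P) : Indep (m₁ ⊔ m₂) m₃ P := by
  rw [Indep_iff] at h h'
  refine indep_sup_left_of_forall h₁ h₂ h₃ fun A B C hA hB hC => ?_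
  have hB' := (le_sup_left : m₂ ≤ m₂ ⊔ m₃) B hB
  rw [Set.inter_assoc, h A (B ∩ C) hA (hB'.inter ((le_sup_right : m₃ ≤ m₂ ⊔ m₃) C hC)),
    h' B C hB hC, h A B hA hB', mul_assoc]

/-- If `𝒜` and `ℬ` are conditionally independent given `𝒢`, and `ℬ` is independent of `𝒢`, then
`ℬ` is independent of `𝒜 ⊔ 𝒢`. -/
lemma CondIndepPair.indep_sup {𝒢 𝒜 ℬ mΩ : MeasurableSpace Ω} {P : Measure Ω}
    [IsProbabilityMeasure P] (hG : 𝒢 ≤ mΩ) (hA : 𝒜 ≤ mΩ) (hB : ℬ ≤ mΩ)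
    (h : CondIndepPair P 𝒢 𝒜 ℬ) (h' : Indep 𝒢 ℬ P) : Indep (𝒜 ⊔ 𝒢) ℬ P := by
  refine indep_sup_left_of_forall hA hG hB fun A G B mA mG mB => ?_
  have mA' := hA A mA
  have mB' := hB B mB
  have hint : ∀ {E : Set Ω}, MeasurableSet E → ∫ ω in G, (P⟦E|𝒢⟧) ω ∂P = P.real (E ∩ G) := by
    intro E hE
    rw [setIntegral_condExp hG ((integrable_const _).indicator hE) mG,
      integral_indicator_const _ hE, measureReal_restrict_apply hE, smul_eq_mul, mul_one]
  -- Independence from `𝒢` makes the conditional probability of `B` constant, so it leaves the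
  -- integral of the conditional product.
  have hconst : P⟦B|𝒢⟧ =ᵐ[P] fun _ => P.real B := by
    have := condExp_indep_eq (f := B.indicator fun _ => (1 : ℝ)) hB hG
      (stronglyMeasurable_const.indicator mB) h'.symm
    rwa [integral_indicator_const _ mB', smul_eq_mul, mul_one] at this
  have key : P.real (A ∩ B ∩ G) = P.real (A ∩ G) * P.real B := by
    rw [← hint (mA'.inter mB'), ← hint mA', ← integral_mul_const]
    refine integral_congr_ae (ae_restrict_of_ae ?_)
    filter_upwards [h A B mA mB, hconst] with ω h1 h2
    rw [h1, h2]
  rw [Set.inter_right_comm, ← ENNReal.toReal_eq_toReal_iff' (by finiteness) (by finiteness),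
    ENNReal.toReal_mul]
  exact key

end Measure

/-! ### Histories and intensity -/

/-- The σ-algebra generated by `Θ` and by the values of `N` at the times in `I`. -/
abbrev history {Ω : Type*} (N : ℝ≥0 → Ω → ℕ) (Θ : Ω → ℝ) (I : Set ℝ≥0) : MeasurableSpace Ω :=
  (⨆ u ∈ I, MeasurableSpace.comap (N u) inferInstance) ⊔ MeasurableSpace.comap Θ inferInstance

/-- The increments of `N` have the intensity `Θ` with respect to the history of `N` and `Θ`:
`E[N_t - N_s; A] = E[(t - s) Θ; A]` for all `s ≤ t` and all `A` in the history up to `s`. -/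
def HasIntensity {Ω : Type*} [MeasurableSpace Ω] (N : ℝ≥0 → Ω → ℕ) (Θ : Ω → ℝ)
    (P : Measure Ω) : Prop :=
  ∀ s t : ℝ≥0, s ≤ t → ∀ A, MeasurableSet[history N Θ (Set.Iic s)] A →
    ∫⁻ ω in A, ((N t ω - N s ω : ℕ) : ℝ≥0∞) ∂P =
      ∫⁻ ω in A, ENNReal.ofReal (((t : ℝ) - s) * Θ ω) ∂P

section History

variable {Ω : Type*} {N : ℝ≥0 → Ω → ℕ} {Θ : Ω → ℝ} {I J : Set ℝ≥0}

lemma history_mono (h : I ⊆ J) : history N Θ I ≤ history N Θ J :=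
  sup_le_sup_right (biSup_mono fun _ hu => h hu) _

lemma measurable_history {u : ℝ≥0} (hu : u ∈ I) : Measurable[history N Θ I] (N u) :=
  (comap_measurable (N u)).mono
    ((le_iSup₂ (f := fun u (_ : u ∈ I) => MeasurableSpace.comap (N u) inferInstance) u hu).trans
      le_sup_left) le_rfl

lemma measurable_history_param : Measurable[history N Θ I] Θ :=
  (comap_measurable Θ).mono le_sup_right le_rfl

lemma history_le {m : MeasurableSpace Ω} (hN : ∀ u ∈ I, Measurable[m] (N u))
    (hΘ : Measurable[m] Θ) : history N Θ I ≤ m :=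
  sup_le (iSup₂_le fun u hu => (hN u hu).comap_le) hΘ.comap_le

end History

/-! ### Wald's identity and the martingale property -/

section Risk

variable {Ω : Type*} [mΩ : MeasurableSpace Ω] {P : Measure Ω} [IsProbabilityMeasure P]
  {N : ℝ≥0 → Ω → ℕ} {X : ℕ → Ω → ℝ} {Θ : Ω → ℝ}

/-- The claim sizes are independent of the pair of `N` and `Θ`. -/
lemma IsRiskProcess.indep_history (hNX : IsRiskProcess N X P) (hΘ : Measurable Θ)
    (ha1 : CondA1 N X Θ P) (ha2 : CondA2 X Θ P) :
    Indep (history N Θ Set.univ) (MeasurableSpace.comap (fun ω n => X n ω) inferInstance) P := by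
  have hT : ∀ n, Measurable (arrivalTime N n) := fun n => by
    refine measurable_of_Iic fun t => ?_
    have : arrivalTime N n ⁻¹' Set.Iic t = N t ⁻¹' Set.Ici n := by
      ext ω
      exact hNX.counting.arrivalTime_le_iff n ω t
    rw [this]
    exact hNX.counting.measurable t measurableSet_Ici
  have hW : Measurable (fun ω n => interarrival N n ω) := measurable_pi_lambda _ fun n =>
    (hT (n + 1)).coe_nnreal_real.sub (hT n).coe_nnreal_real
  have hX : Measurable (fun ω n => X n ω) := measurable_pi_lambda _ hNX.measurable_size
  have h := CondIndepPair.indep_sup hΘ.comap_le hW.comap_le hX.comap_le ha1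
    (IndepFun_iff_Indep _ _ _ |>.1 ha2)
  refine indep_of_indep_of_le_left h (history_le (fun u _ => ?_) ?_)
  · exact (hNX.counting.measurable_comap_interarrival u).mono le_sup_left le_rfl
  · exact (comap_measurable Θ).mono le_sup_right le_rfl

/-- The σ-algebra generated by `N`, `Θ` and the first `k` claim sizes. -/
abbrev claimHistory {Ω : Type*} (N : ℝ≥0 → Ω → ℕ) (X : ℕ → Ω → ℝ) (Θ : Ω → ℝ) (k : ℕ) :
    MeasurableSpace Ω :=
  history N Θ Set.univ ⊔ ⨆ i ∈ Set.Iio k, MeasurableSpace.comap (X i) inferInstance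

lemma IsRiskProcess.claimHistory_le (hNX : IsRiskProcess N X P) (hΘ : Measurable Θ) (k : ℕ) :
    claimHistory N X Θ k ≤ mΩ :=
  sup_le (history_le (fun u _ => hNX.counting.measurable u) hΘ)
    (iSup₂_le fun i _ => (hNX.measurable_size i).comap_le)

/-- Two independences combine: that of `(N, Θ)` from the whole claim sequence, and that of one claim
from its predecessors. -/
lemma IsRiskProcess.indep_claimHistory (hNX : IsRiskProcess N X P) (hΘ : Measurable Θ)
    (ha1 : CondA1 N X Θ P) (ha2 : CondA2 X Θ P) (k : ℕ) :
    Indep (claimHistory N X Θ k) (MeasurableSpace.comap (X k) inferInstance) P := by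
  have hcomap : ∀ i, MeasurableSpace.comap (X i) inferInstance ≤
      MeasurableSpace.comap (fun ω n => X n ω) inferInstance := fun i =>
    ((measurable_pi_apply i).comp (comap_measurable (fun ω n => X n ω))).comap_le
  refine indep_sup_left (history_le (fun u _ => hNX.counting.measurable u) hΘ)
    (iSup₂_le fun i _ => (hNX.measurable_size i).comap_le) (hNX.measurable_size k).comap_le
    (indep_of_indep_of_le_right (hNX.indep_history hΘ ha1 ha2)
      (sup_le (iSup₂_le fun i _ => hcomap i) (hcomap k))) ?_
  have := indep_iSup_of_disjoint (fun i => (hNX.measurable_size i).comap_le)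
    ((iIndepFun_iff_iIndep _ _ _).1 hNX.size_indep) (S := Set.Iio k) (T := {k}) (by simp)
  simpa using this

/-- The σ-algebra of the sets whose trace on `E` belongs to `m`. -/
abbrev traceSpace {Ω : Type*} (m : MeasurableSpace Ω) (E : Set Ω) (hE : MeasurableSet[m] E) :
    MeasurableSpace Ω where
  MeasurableSet' F := MeasurableSet[m] (F ∩ E)
  measurableSet_empty := by simp
  measurableSet_compl F hF := by
    have : Fᶜ ∩ E = E \ (F ∩ E) := by ext; simp; tauto
    rw [this]
    exact hE.diff hF
  measurableSet_iUnion F hF := by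
    rw [Set.iUnion_inter]
    exact MeasurableSet.iUnion hF

/-- Used to replace `S_u`, on the event `N_s ≤ k`, by the sum cut off after `k` claims. -/
lemma measurable_traceSpace {Ω : Type*} {m : MeasurableSpace Ω} {E : Set Ω}
    (hE : MeasurableSet[m] E) {f g : Ω → ℝ} (hg : Measurable[m] g) (hfg : ∀ ω ∈ E, f ω = g ω) :
    Measurable[traceSpace m E hE] f := by
  intro B hB
  have : f ⁻¹' B ∩ E = g ⁻¹' B ∩ E := by
    ext ω
    simp only [Set.mem_inter_iff, Set.mem_preimage, and_congr_left_iff]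
    intro h
    rw [hfg ω h]
  change MeasurableSet[m] (f ⁻¹' B ∩ E)
  rw [this]
  exact (hg hB).inter hE

lemma measurable_sum_range_min {Ω : Type*} {m : MeasurableSpace Ω} {k : ℕ} {n : Ω → ℕ}
    {x : ℕ → Ω → ℝ} (hn : Measurable n) (hx : ∀ i < k, Measurable (x i)) :
    Measurable fun ω => ∑ i ∈ Finset.range (min (n ω) k), x i ω := by
  have : (fun ω => ∑ i ∈ Finset.range (min (n ω) k), x i ω) =
      fun ω => ∑ i ∈ Finset.range k, {ω | i < n ω}.indicator (x i) ω := by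
    funext ω
    simp only [Set.indicator_apply, Set.mem_ofPred_eq]
    rw [← Finset.sum_filter]
    congr 1
    ext i
    simp [and_comm]
  rw [this]
  exact Finset.measurable_sum _ fun i hi =>
    (hx i (Finset.mem_range.1 hi)).indicator (hn measurableSet_Ioi)

/-- Before the `(k+1)`-st claim, the history of the aggregate process only depends on `N`, `Θ` and
the first `k` claim sizes. -/
lemma IsRiskProcess.measurableSet_inter_claimHistory (hNX : IsRiskProcess N X P)
    (hΘ : Measurable Θ) (s : ℝ≥0) (k : ℕ) {F : Set Ω}
    (hF : MeasurableSet[canonicalFiltration (aggregate N X) Θ hNX.measurable_aggregate hΘ s] F) :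
    MeasurableSet[claimHistory N X Θ k] (F ∩ {ω | N s ω ≤ k}) := by
  have hNm : ∀ u, Measurable[claimHistory N X Θ k] (N u) := fun u =>
    (measurable_history (Set.mem_univ u)).mono le_sup_left le_rfl
  have hE : MeasurableSet[claimHistory N X Θ k] {ω | N s ω ≤ k} := hNm s measurableSet_Iic
  suffices (canonicalFiltration (aggregate N X) Θ hNX.measurable_aggregate hΘ s) ≤
      traceSpace (claimHistory N X Θ k) _ hE from this F hF
  refine sup_le (iSup₂_le fun u hu => Measurable.comap_le ?_) (Measurable.comap_le ?_)
  · refine measurable_traceSpace hE (g := fun ω => ∑ i ∈ Finset.range (min (N u ω) k), X i ω)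
      (measurable_sum_range_min (hNm u) fun i hi => ?_) fun ω hω => ?_
    · exact (comap_measurable (X i)).mono
        ((le_iSup₂ (f := fun i (_ : i ∈ Set.Iio k) => MeasurableSpace.comap (X i) inferInstance)
          i hi).trans le_sup_right) le_rfl
    -- Where `N_s ≤ k`, also `N_u ≤ k`, so the cut-off has no effect.
    · have h1 : N u ω ≤ N s ω := hNX.counting.mono ω hu
      rw [min_eq_left (h1.trans hω)]
      rfl
  · exact measurable_traceSpace hE (measurable_history_param.mono le_sup_left le_rfl)
      fun _ _ => rfl

/-- Wald's identity for the increments of the aggregate process on the events of its history. -/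
lemma IsRiskProcess.setLIntegral_aggregate_sub (hNX : IsRiskProcess N X P)
    (hΘ : Measurable Θ) (ha1 : CondA1 N X Θ P) (ha2 : CondA2 X Θ P) {s t : ℝ≥0} (hst : s ≤ t)
    {F : Set Ω}
    (hF : MeasurableSet[canonicalFiltration (aggregate N X) Θ hNX.measurable_aggregate hΘ s] F) :
    ∫⁻ ω in F, ENNReal.ofReal (aggregate N X t ω - aggregate N X s ω) ∂P =
      (∫⁻ ω in F, ((N t ω - N s ω : ℕ) : ℝ≥0∞) ∂P) * ∫⁻ ω, ENNReal.ofReal (X 0 ω) ∂P := by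
  have hFm : MeasurableSet F := (canonicalFiltration _ Θ hNX.measurable_aggregate hΘ).le s F hF
  -- The event that the claim `X k` arrives in `(s, t]`; the increments of `S` and of `N` are sums
  -- over these events.
  set E : ℕ → Set Ω := fun k => {ω | N s ω ≤ k} ∩ {ω | k < N t ω} with hE
  have hEm : ∀ k, MeasurableSet (E k) := fun k =>
    (hNX.counting.measurable s measurableSet_Iic).inter
      (hNX.counting.measurable t measurableSet_Ioi)
  have hsum : ∀ (ω : Ω) (c : ℕ → ℝ≥0∞), ∑ k ∈ Finset.Ico (N s ω) (N t ω), c k =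
      ∑' k, (E k).indicator (fun _ => c k) ω := by
    intro ω c
    rw [tsum_eq_sum (s := Finset.Ico (N s ω) (N t ω)) fun k hk => ?_]
    · refine Finset.sum_congr rfl fun k hk => ?_
      rw [Set.indicator_of_mem]
      exact Finset.mem_Ico.1 hk
    · rw [Set.indicator_of_notMem]
      exact fun h => hk (Finset.mem_Ico.2 h)
  have hS : ∀ ω, ENNReal.ofReal (aggregate N X t ω - aggregate N X s ω) =
      ∑' k, (E k).indicator (fun ω => ENNReal.ofReal (X k ω)) ω := by
    intro ω
    have h1 : N s ω ≤ N t ω := hNX.counting.mono ω hst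
    rw [aggregate, aggregate, ← Finset.sum_Ico_eq_sub _ h1,
      ENNReal.ofReal_sum_of_nonneg fun k _ => (hNX.size_pos k ω).le, hsum]
    rfl
  have hN : ∀ ω, ((N t ω - N s ω : ℕ) : ℝ≥0∞) = ∑' k, (E k).indicator (fun _ => 1) ω := by
    intro ω
    rw [← hsum ω fun _ => 1]
    simp
  have hXm : ∀ k, Measurable fun ω => ENNReal.ofReal (X k ω) := fun k =>
    (hNX.measurable_size k).ennreal_ofReal
  simp_rw [hS, hN]
  rw [lintegral_tsum fun k => ((hXm k).indicator (hEm k)).aemeasurable,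
    lintegral_tsum fun k => (measurable_const.indicator (hEm k)).aemeasurable,
    ← ENNReal.tsum_mul_right]
  congr 1
  funext k
  -- The condition `N_s ≤ k` reduces `F` to the first `k` claims. The later value `N_t` is harmless
  -- since `claimHistory` contains the whole path of `N`.
  have hFE : MeasurableSet[claimHistory N X Θ k] (F ∩ E k) := by
    rw [hE, ← Set.inter_assoc]
    exact (hNX.measurableSet_inter_claimHistory hΘ s k hF).inter
      (((measurable_history (Set.mem_univ t)).mono le_sup_left le_rfl :
        Measurable[claimHistory N X Θ k] (N t)) measurableSet_Ioi)
  have hFE' := hNX.claimHistory_le hΘ k _ hFE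
  have hind := lintegral_mul_eq_lintegral_mul_lintegral_of_independent_measurableSpace
    (f := (F ∩ E k).indicator fun _ => 1) (g := fun ω => ENNReal.ofReal (X k ω))
    (hNX.claimHistory_le hΘ k) (hNX.measurable_size k).comap_le
    (hNX.indep_claimHistory hΘ ha1 ha2 k) (measurable_const.indicator hFE)
    (comap_measurable (X k)).ennreal_ofReal
  have hid : ∫⁻ ω, ENNReal.ofReal (X k ω) ∂P = ∫⁻ ω, ENNReal.ofReal (X 0 ω) ∂P :=
    ((hNX.size_identDistrib k).comp ENNReal.measurable_ofReal).lintegral_eq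
  rw [hid] at hind
  rw [← lintegral_indicator hFm, ← lintegral_indicator hFm, Set.indicator_indicator,
    Set.indicator_indicator, ← hind]
  refine lintegral_congr fun ω => ?_
  by_cases hω : ω ∈ F ∩ E k <;> simp [hω]

/-- The intensity property extends to the events that also depend on the claim sizes. -/
lemma HasIntensity.setLIntegral_eq (h : HasIntensity N Θ P) (hNX : IsRiskProcess N X P)
    (hΘ : Measurable Θ) (hΘ_int : Integrable Θ P)
    (ha1 : CondA1 N X Θ P) (ha2 : CondA2 X Θ P) {s t : ℝ≥0} (hst : s ≤ t) {F : Set Ω}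
    (hF : MeasurableSet[history N Θ (Set.Iic s) ⊔
      MeasurableSpace.comap (fun ω n => X n ω) inferInstance] F) :
    ∫⁻ ω in F, ((N t ω - N s ω : ℕ) : ℝ≥0∞) ∂P =
      ∫⁻ ω in F, ENNReal.ofReal (((t : ℝ) - s) * Θ ω) ∂P := by
  have hX : Measurable (fun ω n => X n ω) := measurable_pi_lambda _ hNX.measurable_size
  have hH : ∀ I, history N Θ I ≤ mΩ := fun I =>
    history_le (fun u _ => hNX.counting.measurable u) hΘ
  have hFm : MeasurableSet F := sup_le (hH _) hX.comap_le F hF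
  -- Independence of the claims from `(N, Θ)` factors out `P B`, leaving an identity on the history
  -- of `N` and `Θ` alone.
  have hprod : ∀ f : Ω → ℝ≥0∞, Measurable[history N Θ Set.univ] f →
      ∀ A, MeasurableSet[history N Θ (Set.Iic s)] A →
      ∀ B, MeasurableSet[MeasurableSpace.comap (fun ω n => X n ω) inferInstance] B →
      (P.withDensity f) (A ∩ B) = (∫⁻ ω in A, f ω ∂P) * P B := by
    intro f hf A hA B hB
    have hAm := hH _ A hA
    have hBm := hX.comap_le B hB
    have := lintegral_mul_eq_lintegral_mul_lintegral_of_independent_measurableSpace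
      (f := A.indicator f) (g := B.indicator fun _ => 1) (hH _) hX.comap_le
      (hNX.indep_history hΘ ha1 ha2) (hf.indicator (history_mono (Set.subset_univ _) A hA))
      (measurable_const.indicator hB)
    rw [lintegral_indicator hAm, lintegral_indicator_const hBm, one_mul] at this
    rw [withDensity_apply _ (hAm.inter hBm), ← lintegral_indicator (hAm.inter hBm), ← this]
    refine lintegral_congr fun ω => ?_
    by_cases h1 : ω ∈ A <;> by_cases h2 : ω ∈ B <;> simp [h1, h2]
  have hf1 : Measurable[history N Θ Set.univ] fun ω => ENNReal.ofReal (((t : ℝ) - s) * Θ ω) :=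
    (measurable_history_param.const_mul _).ennreal_ofReal
  have hf2 : Measurable[history N Θ Set.univ] fun ω => ((N t ω - N s ω : ℕ) : ℝ≥0∞) :=
    (measurable_of_countable (fun n : ℕ × ℕ => ((n.1 - n.2 : ℕ) : ℝ≥0∞))).comp
      ((measurable_history (Set.mem_univ t)).prodMk (measurable_history (Set.mem_univ s)))
  -- Integrability of `Θ` supplies the finiteness needed for uniqueness on a π-system.
  have : IsFiniteMeasure (P.withDensity fun ω => ENNReal.ofReal (((t : ℝ) - s) * Θ ω)) :=
    isFiniteMeasure_withDensity_ofReal (hΘ_int.const_mul _).2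
  have hAB : ∀ A, MeasurableSet[history N Θ (Set.Iic s)] A →
      ∀ B, MeasurableSet[MeasurableSpace.comap (fun ω n => X n ω) inferInstance] B →
      P.withDensity (fun ω => ENNReal.ofReal (((t : ℝ) - s) * Θ ω)) (A ∩ B) =
        P.withDensity (fun ω => ((N t ω - N s ω : ℕ) : ℝ≥0∞)) (A ∩ B) := by
    intro A hA B hB
    rw [hprod _ hf1 A hA B hB, hprod _ hf2 A hA B hB, h s t hst A hA]
  have key := measure_eq_on_sup {A | MeasurableSet[history N Θ (Set.Iic s)] A}
    (@MeasurableSpace.isPiSystem_measurableSet _ (history N Θ (Set.Iic s)))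
    (@MeasurableSpace.generateFrom_measurableSet _ (history N Θ (Set.Iic s))).symm (hH _)
    hX.comap_le (fun B hB => by
      have := hAB Set.univ MeasurableSet.univ B hB
      rwa [Set.univ_inter] at this) hAB hF
  rw [withDensity_apply _ hFm, withDensity_apply _ hFm] at key
  exact key.symm

/-- `N` has the intensity `Θ` if and only if the compensated aggregate process is balanced. -/
lemma IsRiskProcess.hasIntensity_iff (hNX : IsRiskProcess N X P)
    (hΘ : Measurable Θ) (hΘ_int : Integrable Θ P)
    (ha1 : CondA1 N X Θ P) (ha2 : CondA2 X Θ P) (hX_int : Integrable (X 0) P) :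
    HasIntensity N Θ P ↔ ∀ s t : ℝ≥0, s ≤ t → ∀ F,
      MeasurableSet[canonicalFiltration (aggregate N X) Θ hNX.measurable_aggregate hΘ s] F →
      ∫⁻ ω in F, ENNReal.ofReal (aggregate N X t ω - aggregate N X s ω) ∂P =
        (∫⁻ ω in F, ENNReal.ofReal (((t : ℝ) - s) * Θ ω) ∂P) *
          ∫⁻ ω, ENNReal.ofReal (X 0 ω) ∂P := by
  constructor
  · intro h s t hst F hF
    rw [hNX.setLIntegral_aggregate_sub hΘ ha1 ha2 hst hF,
      h.setLIntegral_eq hNX hΘ hΘ_int ha1 ha2 hst]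
    refine (?_ : canonicalFiltration (aggregate N X) Θ hNX.measurable_aggregate hΘ s ≤ _) F hF
    refine sup_le (iSup₂_le fun u hu => Measurable.comap_le ?_) (Measurable.comap_le ?_)
    · have h1 : Measurable (fun p : ℕ × (ℕ → ℝ) => ∑ k ∈ Finset.range p.1, p.2 k) :=
        measurable_from_prod_countable_right fun n =>
          Finset.measurable_sum (f := fun k (x : ℕ → ℝ) => x k) (Finset.range n)
            fun k _ => measurable_pi_apply k
      exact h1.comp (((measurable_history (I := Set.Iic s) hu).mono le_sup_left le_rfl).prodMk
        ((comap_measurable (fun ω n => X n ω)).mono le_sup_right le_rfl))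
    · exact measurable_history_param.mono le_sup_left le_rfl
  · intro h s t hst A hA
    have hA' : MeasurableSet[canonicalFiltration (aggregate N X) Θ
        hNX.measurable_aggregate hΘ s] A := by
      refine history_le (fun u hu => ?_) ?_ A hA
      · refine hNX.counting.measurable_of_aggregate hNX.size_pos rfl u fun v hv => ?_
        exact (comap_measurable (aggregate N X v)).mono
          ((le_iSup₂ (f := fun v (_ : v ≤ s) => MeasurableSpace.comap (aggregate N X v) inferInstance)
            v (hv.trans hu)).trans le_sup_left) le_rfl
      · exact (comap_measurable Θ).mono le_sup_right le_rfl
    have h1 := h s t hst A hA'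
    rw [hNX.setLIntegral_aggregate_sub hΘ ha1 ha2 hst hA'] at h1
    refine (ENNReal.mul_left_inj ?_ hX_int.lintegral_lt_top.ne).1 h1
    -- The mean claim can be cancelled: it is finite, and nonzero since claims are strictly
    -- positive.
    rw [Ne, lintegral_eq_zero_iff (hNX.measurable_size 0).ennreal_ofReal]
    intro h0
    obtain ⟨ω, hω⟩ := h0.exists
    exact absurd (ENNReal.ofReal_eq_zero.1 hω) (not_le.2 (hNX.size_pos 0 ω))

/-- The martingale property in terms of the expected increments on the events of the history. -/
lemma IsRiskProcess.martingale_iff (hNX : IsRiskProcess N X P)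
    (hΘ : Measurable Θ) (hΘ_pos : ∀ᵐ ω ∂P, 0 < Θ ω) (hΘ_int : Integrable Θ P)
    (hX_int : Integrable (X 0) P) :
    Martingale (fun (t : ℝ≥0) (ω : Ω) => aggregate N X t ω - (t : ℝ) * Θ ω * ∫ ω', X 0 ω' ∂P)
        (canonicalFiltration (aggregate N X) Θ hNX.measurable_aggregate hΘ) P ↔
      ∀ s t : ℝ≥0, s ≤ t → ∀ F,
      MeasurableSet[canonicalFiltration (aggregate N X) Θ hNX.measurable_aggregate hΘ s] F →
      ∫⁻ ω in F, ENNReal.ofReal (aggregate N X t ω - aggregate N X s ω) ∂P =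
        (∫⁻ ω in F, ENNReal.ofReal (((t : ℝ) - s) * Θ ω) ∂P) *
          ∫⁻ ω, ENNReal.ofReal (X 0 ω) ∂P := by
  set ℱ := canonicalFiltration (aggregate N X) Θ hNX.measurable_aggregate hΘ with hℱ
  set e := ∫ ω, X 0 ω ∂P with he
  have he_eq : ∫⁻ ω, ENNReal.ofReal (X 0 ω) ∂P = ENNReal.ofReal e :=
    (ofReal_integral_eq_lintegral_ofReal hX_int
      (Filter.Eventually.of_forall fun ω => (hNX.size_pos 0 ω).le)).symm
  have he0 : 0 ≤ e := integral_nonneg fun ω => (hNX.size_pos 0 ω).le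
  have hcomp : ∀ t : ℝ≥0, Integrable (fun ω => (t : ℝ) * Θ ω * e) P := fun t =>
    (hΘ_int.const_mul _).mul_const _
  have hinc : ∀ {s t : ℝ≥0}, s ≤ t → ∀ ω, 0 ≤ aggregate N X t ω - aggregate N X s ω :=
    fun {s t} hst ω => sub_nonneg.2
      ((strictMono_sum_range fun n => hNX.size_pos n ω).monotone (hNX.counting.mono ω hst))
  have hΘ0 : ∀ {s t : ℝ≥0}, s ≤ t → ∀ᵐ ω ∂P, 0 ≤ ((t : ℝ) - s) * Θ ω := fun {s t} hst => by
    filter_upwards [hΘ_pos] with ω hω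
    exact mul_nonneg (sub_nonneg.2 (NNReal.coe_le_coe.2 hst)) hω.le
  have hright : ∀ {s t : ℝ≥0}, s ≤ t → ∀ F : Set Ω,
      (∫⁻ ω in F, ENNReal.ofReal (((t : ℝ) - s) * Θ ω) ∂P) * ∫⁻ ω, ENNReal.ofReal (X 0 ω) ∂P =
        ENNReal.ofReal (∫ ω in F, (((t : ℝ) * Θ ω * e) - ((s : ℝ) * Θ ω * e)) ∂P) := by
    intro s t hst F
    rw [he_eq, ← ofReal_integral_eq_lintegral_ofReal (hΘ_int.const_mul _).integrableOn
      (ae_restrict_of_ae (hΘ0 hst)), ← ENNReal.ofReal_mul' he0, ← integral_mul_const]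
    congr 2
    funext ω
    ring
  -- Increments of `S` and of its compensator are nonnegative almost surely, so once `S` is
  -- integrable the identity passes between the two kinds of integral.
  have hiff : (∀ t, Integrable (aggregate N X t) P) → ∀ {s t : ℝ≥0}, s ≤ t → ∀ F : Set Ω,
      (∫⁻ ω in F, ENNReal.ofReal (aggregate N X t ω - aggregate N X s ω) ∂P =
        (∫⁻ ω in F, ENNReal.ofReal (((t : ℝ) - s) * Θ ω) ∂P) *
          ∫⁻ ω, ENNReal.ofReal (X 0 ω) ∂P ↔
      ∫ ω in F, (aggregate N X s ω - (s : ℝ) * Θ ω * e) ∂P =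
        ∫ ω in F, (aggregate N X t ω - (t : ℝ) * Θ ω * e) ∂P) := by
    intro hS s t hst F
    have hleft := ofReal_integral_eq_lintegral_ofReal (μ := P.restrict F)
      (f := fun ω => aggregate N X t ω - aggregate N X s ω)
      ((hS t).sub (hS s)).integrableOn (Filter.Eventually.of_forall fun ω => hinc hst ω)
    rw [hright hst, ← hleft,
      ENNReal.ofReal_eq_ofReal_iff (integral_nonneg fun ω => hinc hst ω) ?_,
      integral_sub (hS t).integrableOn (hS s).integrableOn,
      integral_sub (hcomp t).integrableOn (hcomp s).integrableOn,
      integral_sub (hS t).integrableOn (hcomp t).integrableOn,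
      integral_sub (hS s).integrableOn (hcomp s).integrableOn]
    · constructor <;> intro h <;> linarith
    · refine integral_nonneg_of_ae (ae_restrict_of_ae ?_)
      filter_upwards [hΘ0 hst] with ω hω
      have := mul_nonneg hω he0
      simp only [Pi.zero_apply]
      linarith
  constructor
  · intro h s t hst F hF
    have hS : ∀ t, Integrable (aggregate N X t) P := fun t => by
      have := (h.integrable t).add (hcomp t)
      refine this.congr (Filter.Eventually.of_forall fun ω => ?_)
      simp
    exact (hiff hS hst F).2 (h.setIntegral_eq hst hF)
  · intro h
    have hS : ∀ t, Integrable (aggregate N X t) P := fun t => by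
      refine ⟨(hNX.measurable_aggregate t).aestronglyMeasurable, ?_⟩
      have h0 : ∀ ω, aggregate N X 0 ω = 0 := fun ω => by simp [aggregate, hNX.counting.zero]
      -- Integrability of `S_t` is itself the case `s = 0`, `F = Ω` of the identity, as `S_0 = 0`.
      have h1 := h 0 t (zero_le) Set.univ MeasurableSet.univ
      rw [hright (zero_le)] at h1
      rw [hasFiniteIntegral_iff_ofReal (Filter.Eventually.of_forall fun ω => by
        simpa [h0] using hinc (zero_le : 0 ≤ t) ω)]
      simp only [h0, sub_zero, Measure.restrict_univ] at h1
      rw [h1]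
      exact ENNReal.ofReal_lt_top
    have hint : ∀ t : ℝ≥0, Integrable (fun ω => aggregate N X t ω - (t : ℝ) * Θ ω * e) P :=
      fun t => (hS t).sub (hcomp t)
    have hadapted : ∀ t : ℝ≥0,
        StronglyMeasurable[ℱ t] fun ω => aggregate N X t ω - (t : ℝ) * Θ ω * e := fun t => by
      refine Measurable.stronglyMeasurable (Measurable.sub ?_ (Measurable.mul_const
        (Measurable.const_mul ?_ _) _))
      · exact (comap_measurable (aggregate N X t)).mono
          ((le_iSup₂ (f := fun v (_ : v ≤ t) =>
            MeasurableSpace.comap (aggregate N X v) inferInstance) t le_rfl).trans le_sup_left)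
          le_rfl
      · exact (comap_measurable Θ).mono le_sup_right le_rfl
    refine ⟨hadapted, fun s t hst => ?_⟩
    symm
    refine ae_eq_condExp_of_forall_setIntegral_eq (ℱ.le s) (hint t)
      (fun F _ _ => (hint s).integrableOn) (fun F hF _ => ?_) (hadapted s).aestronglyMeasurable
    exact (hiff hS hst F).1 (h s t hst F hF)

end Risk

/-! ### Generating functions -/

section PowerSeries

open Filter Topology

/-- Once the coefficients before `k` vanish, dividing by `z ^ k` expresses `-d k` as a tail bounded
by `C z / (1 - z)`, which tends to zero as `z` decreases to zero. -/
lemma eq_zero_of_hasSum_mul_pow {d : ℕ → ℝ} {C : ℝ} (hC : ∀ n, |d n| ≤ C)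
    (h : ∀ z : ℝ, 0 < z → z < 1 → HasSum (fun n => d n * z ^ n) 0) (n : ℕ) : d n = 0 := by
  induction n using Nat.strong_induction_on with
  | _ k ih =>
    have hbound : ∀ z : ℝ, 0 < z → z < 1 → |d k| ≤ C * z * (1 - z)⁻¹ := by
      intro z hz hz1
      have h1 : HasSum (fun n => d (n + k) * z ^ (n + k)) 0 := by
        rw [hasSum_nat_add_iff (f := fun n => d n * z ^ n)]
        rw [Finset.sum_eq_zero fun i hi => by rw [ih i (Finset.mem_range.1 hi), zero_mul], add_zero]
        exact h z hz hz1
      have h2 : HasSum (fun n => d (n + k) * z ^ n) 0 := by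
        have := h1.mul_right (z ^ k)⁻¹
        rw [zero_mul] at this
        refine this.congr_fun fun n => ?_
        rw [pow_add]
        field_simp
      have h3 : HasSum (fun n => d (n + 1 + k) * z ^ (n + 1)) (-d k) := by
        rw [hasSum_nat_add_iff (f := fun n => d (n + k) * z ^ n) 1]
        simpa using h2
      have h4 : HasSum (fun n => C * z * z ^ n) (C * z * (1 - z)⁻¹) :=
        (hasSum_geometric_of_lt_one hz.le hz1).mul_left _
      rw [← abs_neg (d k)]
      refine h3.norm_le_of_bounded h4 fun n => ?_
      rw [norm_mul, Real.norm_eq_abs, Real.norm_of_nonneg (by positivity), pow_succ']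
      calc _ ≤ C * (z * z ^ n) := by gcongr; exact hC _
        _ = _ := by ring
    have hlim : Tendsto (fun z : ℝ => C * z * (1 - z)⁻¹) (𝓝[>] 0) (𝓝 0) := by
      have : ContinuousAt (fun z : ℝ => C * z * (1 - z)⁻¹) 0 := by
        refine ContinuousAt.mul (by fun_prop) (ContinuousAt.inv₀ (by fun_prop) (by norm_num))
      have h0 := this.tendsto
      simp only [mul_zero, sub_zero, inv_one, mul_one] at h0
      exact h0.mono_left nhdsWithin_le_nhds
    have : |d k| ≤ 0 := by
      refine ge_of_tendsto hlim ?_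
      filter_upwards [Ioo_mem_nhdsGT (zero_lt_one' ℝ)] with z hz
      exact hbound z hz.1 hz.2
    exact abs_nonpos_iff.1 this

/-- A bounded sequence is determined by its generating function on `(0, 1)`. -/
lemma eq_of_tsum_ofReal_pow_mul_eq {a b : ℕ → ℝ≥0∞} (ha : ∀ n, a n ≤ 1) (hb : ∀ n, b n ≤ 1)
    (h : ∀ z : ℝ, 0 < z → z < 1 →
      ∑' n, ENNReal.ofReal (z ^ n) * a n = ∑' n, ENNReal.ofReal (z ^ n) * b n) (n : ℕ) :
    a n = b n := by
  have hsum : ∀ {c : ℕ → ℝ≥0∞}, (∀ n, c n ≤ 1) → ∀ z : ℝ, 0 < z → z < 1 →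
      HasSum (fun n => (c n).toReal * z ^ n) (∑' n, ENNReal.ofReal (z ^ n) * c n).toReal := by
    intro c hc z hz hz1
    have hfin : ∑' n, ENNReal.ofReal (z ^ n) * c n ≠ ∞ := by
      refine ne_top_of_le_ne_top ?_ (ENNReal.tsum_le_tsum fun n =>
        mul_le_mul_right (hc n) (ENNReal.ofReal (z ^ n)))
      simp_rw [mul_one]
      rw [← ENNReal.ofReal_tsum_of_nonneg (fun n => by positivity)
        (summable_geometric_of_lt_one hz.le hz1)]
      exact ENNReal.ofReal_ne_top
    rw [ENNReal.tsum_toReal_eq (ENNReal.ne_top_of_tsum_ne_top hfin)]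
    refine (ENNReal.hasSum_toReal hfin).congr_fun fun n => ?_
    rw [ENNReal.toReal_mul, ENNReal.toReal_ofReal (by positivity), mul_comm]
  have h1 : ∀ {c : ℕ → ℝ≥0∞}, (∀ n, c n ≤ 1) → ∀ n, c n ≠ ∞ := fun hc n =>
    ne_top_of_le_ne_top ENNReal.one_ne_top (hc n)
  have key := eq_zero_of_hasSum_mul_pow (d := fun n => (a n).toReal - (b n).toReal) (C := 1)
    (fun n => ?_) (fun z hz hz1 => ?_) n
  · rw [← ENNReal.toReal_eq_toReal_iff' (h1 ha n) (h1 hb n)]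
    exact sub_eq_zero.1 key
  · have ha' : (a n).toReal ≤ 1 := ENNReal.toReal_le_of_le_ofReal zero_le_one (by simpa using ha n)
    have hb' : (b n).toReal ≤ 1 := ENNReal.toReal_le_of_le_ofReal zero_le_one (by simpa using hb n)
    exact abs_sub_le_of_nonneg_of_le ENNReal.toReal_nonneg ha' ENNReal.toReal_nonneg hb'
  · have := (hsum ha z hz hz1).sub (hsum hb z hz hz1)
    rw [h z hz hz1, sub_self] at this
    exact this.congr_fun fun n => by ring

lemma tsum_ofReal_pow_mul_poissonMeasure (r : ℝ≥0) {z : ℝ} (hz : 0 ≤ z) :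
    ∑' n, ENNReal.ofReal (z ^ n) * poissonMeasure r {n} =
      ENNReal.ofReal (Real.exp (-((1 - z) * r))) := by
  have hs : HasSum (fun n : ℕ => z ^ n * (Real.exp (-r) * r ^ n / n.factorial))
      (Real.exp (-((1 - z) * r))) := by
    have := (NormedSpace.expSeries_div_hasSum_exp (z * r : ℝ)).mul_left (Real.exp (-r))
    rw [← Real.exp_eq_exp_ℝ, ← Real.exp_add] at this
    have he : -(r : ℝ) + z * r = -((1 - z) * r) := by ring
    rw [he] at this
    refine this.congr_fun fun n => ?_
    rw [mul_pow]
    ring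
  rw [← hs.tsum_eq, ENNReal.ofReal_tsum_of_nonneg (fun n => by positivity) hs.summable]
  congr 1
  funext n
  rw [poissonMeasure_singleton, ENNReal.ofReal_mul (by positivity)]

end PowerSeries

/-- Given `Θ`, the increments of `N` are Poisson distributed and independent of the history:
`P(A ∩ {N_t - N_s = n}) = E[Poisson((t - s) Θ){n}; A]` for all `A` in the history up to `s`. -/
def HasPoissonIncrements {Ω : Type*} [MeasurableSpace Ω] (N : ℝ≥0 → Ω → ℕ) (Θ : Ω → ℝ)
    (P : Measure Ω) : Prop :=
  ∀ s t : ℝ≥0, s < t → ∀ A, MeasurableSet[history N Θ (Set.Iic s)] A → ∀ n : ℕ,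
    P (A ∩ {ω | N t ω - N s ω = n}) =
      ∫⁻ ω in A, poissonMeasure ((t - s) * (Θ ω).toNNReal) {n} ∂P

/-! ### Watanabe's theorem: intensity implies Poisson increments -/

section Watanabe

open Filter Topology

lemma exp_neg_sub_nonneg (x : ℝ) : 0 ≤ Real.exp (-x) - 1 + x := by
  linarith [Real.add_one_le_exp (-x)]

lemma exp_neg_sub_le {x : ℝ} (hx : 0 ≤ x) : Real.exp (-x) - 1 + x ≤ x := by
  linarith [Real.exp_le_one_iff.2 (neg_nonpos.2 hx)]

lemma exp_neg_sub_le_sq {x : ℝ} (hx : 0 ≤ x) : Real.exp (-x) - 1 + x ≤ x ^ 2 := by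
  rcases le_total x 1 with h | h
  · have := (abs_le.1 (Real.abs_exp_sub_one_sub_id_le (x := -x) (by rw [abs_neg, abs_of_nonneg hx]; exact h))).2
    nlinarith
  · exact (exp_neg_sub_le hx).trans (by nlinarith)

lemma one_sub_pow_sub_nonneg {c : ℝ} (hc1 : c ≤ 1) (n : ℕ) :
    0 ≤ (1 - c) ^ n - 1 + c * n := by
  have := one_add_mul_le_pow (a := -c) (by linarith) n
  rw [← sub_eq_add_neg] at this
  linarith

/-- The linearization is exact for `n = 0` and `n = 1`, so an interval contributes an error only if
it carries at least two jumps; the crude bound `n` then suffices. -/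
lemma one_sub_pow_sub_le {c : ℝ} (hc0 : 0 ≤ c) (hc1 : c ≤ 1) (n : ℕ) :
    (1 - c) ^ n - 1 + c * n ≤ if 2 ≤ n then (n : ℝ) else 0 := by
  split_ifs with h
  · have h1 : (1 - c) ^ n ≤ 1 := pow_le_one₀ (by linarith) (by linarith)
    have h2 : c * n ≤ n := mul_le_of_le_one_left (Nat.cast_nonneg n) hc1
    linarith
  · interval_cases n <;> simp

variable {Ω : Type*} [mΩ : MeasurableSpace Ω] {P : Measure Ω} [IsProbabilityMeasure P]
  {N : ℝ≥0 → Ω → ℕ} {Θ : Ω → ℝ}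

lemma IsCountingProcess.measurable_sub (hN : IsCountingProcess N) (s t : ℝ≥0) :
    Measurable fun ω => N t ω - N s ω :=
  (measurable_of_countable (fun n : ℕ × ℕ => n.1 - n.2)).comp
    ((hN.measurable t).prodMk (hN.measurable s))

lemma HasIntensity.integrable_sub (h : HasIntensity N Θ P) (hN : IsCountingProcess N)
    (hΘ_int : Integrable Θ P) {a b : ℝ≥0} (hab : a ≤ b) :
    Integrable (fun ω => ((N b ω - N a ω : ℕ) : ℝ)) P := by
  refine ⟨((measurable_of_countable _).comp (hN.measurable_sub a b)).aestronglyMeasurable, ?_⟩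
  rw [hasFiniteIntegral_iff_ofReal (Eventually.of_forall fun ω => Nat.cast_nonneg _)]
  simp_rw [ENNReal.ofReal_natCast]
  have := h a b hab Set.univ MeasurableSet.univ
  rw [Measure.restrict_univ] at this
  rw [this]
  exact (hΘ_int.const_mul _).lintegral_lt_top

/-- The intensity, tested against nonnegative weights from the past. Both sides are extended
integrals, so no integrability is required, and `ENNReal.ofReal` and `Real.toNNReal` truncate
negative values of `Θ` alike. -/
lemma HasIntensity.integral_mul_sub (h : HasIntensity N Θ P) (hN : IsCountingProcess N)
    (hΘ : Measurable Θ) {a b : ℝ≥0} (hab : a ≤ b) {Y : Ω → ℝ}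
    (hY : Measurable[history N Θ (Set.Iic a)] Y) (hY0 : ∀ ω, 0 ≤ Y ω) :
    ∫ ω, Y ω * ((N b ω - N a ω : ℕ) : ℝ) ∂P =
      ∫ ω, Y ω * (((b : ℝ) - a) * (Θ ω).toNNReal) ∂P := by
  have hH : history N Θ (Set.Iic a) ≤ mΩ := history_le (fun u _ => hN.measurable u) hΘ
  have hYm : Measurable Y := hY.mono hH le_rfl
  have hn : Measurable fun ω => ((N b ω - N a ω : ℕ) : ℝ) :=
    (measurable_of_countable _).comp (hN.measurable_sub a b)
  have hn' : Measurable fun ω => ((N b ω - N a ω : ℕ) : ℝ≥0∞) :=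
    (measurable_of_countable _).comp (hN.measurable_sub a b)
  have hab' : 0 ≤ (b : ℝ) - a := sub_nonneg.2 (NNReal.coe_le_coe.2 hab)
  rw [integral_eq_lintegral_of_nonneg_ae
      (Eventually.of_forall fun ω => mul_nonneg (hY0 ω) (Nat.cast_nonneg _))
      (hYm.mul hn).aestronglyMeasurable,
    integral_eq_lintegral_of_nonneg_ae
      (Eventually.of_forall fun ω => mul_nonneg (hY0 ω) (mul_nonneg hab' (NNReal.coe_nonneg _)))
      (hYm.mul (hΘ.real_toNNReal.coe_nnreal_real.const_mul _)).aestronglyMeasurable]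
  congr 1
  have key := lintegral_mul_eq_of_forall_setLIntegral_eq hH hn' (hΘ.const_mul _).ennreal_ofReal
    (h a b hab) hY.ennreal_ofReal
  simp_rw [ENNReal.ofReal_mul (hY0 _), ENNReal.ofReal_natCast]
  rw [key]
  refine lintegral_congr fun ω => ?_
  rw [ENNReal.ofReal_mul hab', ENNReal.ofReal_mul hab', ENNReal.ofReal_coe_nnreal]
  rfl

/-- The error made on one interval when the generating function of the increment of `N` is
replaced by the one of a Poisson law. -/
noncomputable def errorTerm (c : ℝ) (n : ℕ) (x : ℝ) : ℝ :=
  (if 2 ≤ n then (n : ℝ) else 0) + (Real.exp (-(c * x)) - 1 + c * x)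

lemma errorTerm_nonneg (c : ℝ) (n : ℕ) (x : ℝ) : 0 ≤ errorTerm c n x := by
  refine add_nonneg ?_ (exp_neg_sub_nonneg _)
  split_ifs <;> positivity

lemma errorTerm_le {c x : ℝ} (hc : 0 ≤ c) (hx : 0 ≤ x) (n : ℕ) :
    errorTerm c n x ≤ n + c * x := by
  refine add_le_add ?_ (exp_neg_sub_le (mul_nonneg hc hx))
  split_ifs <;> simp

lemma measurable_errorTerm (c : ℝ) : Measurable fun p : ℕ × ℝ => errorTerm c p.1 p.2 :=
  measurable_from_prod_countable_right fun n => by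
    have h : ∀ d : ℝ, Measurable fun x : ℝ => d + (Real.exp (-(c * x)) - 1 + c * x) :=
      fun d => by fun_prop
    exact h (if 2 ≤ n then (n : ℝ) else 0)

lemma HasIntensity.integrable_errorTerm (h : HasIntensity N Θ P) (hN : IsCountingProcess N)
    (hΘ : Measurable Θ) (hΘ_int : Integrable Θ P) {a b : ℝ≥0} (hab : a ≤ b) {c : ℝ}
    (hc : 0 ≤ c) :
    Integrable (fun ω => errorTerm c (N b ω - N a ω) (((b : ℝ) - a) * (Θ ω).toNNReal)) P := by
  have hab' : 0 ≤ (b : ℝ) - a := sub_nonneg.2 (NNReal.coe_le_coe.2 hab)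
  have hx : Integrable (fun ω => c * (((b : ℝ) - a) * (Θ ω).toNNReal)) P :=
    (hΘ_int.real_toNNReal.const_mul _).const_mul _
  refine ((h.integrable_sub hN hΘ_int hab).add hx).mono' ?_ (Eventually.of_forall fun ω => ?_)
  · exact ((measurable_errorTerm c).comp ((hN.measurable_sub a b).prodMk
      (hΘ.real_toNNReal.coe_nnreal_real.const_mul _))).aestronglyMeasurable
  · rw [Real.norm_of_nonneg (errorTerm_nonneg _ _ _)]
    exact errorTerm_le hc (mul_nonneg hab' (NNReal.coe_nonneg _)) _

/-- With `n` the increment and `x = (b - a)Θ`, the intensity makes `c Y (n - x)` centred. Adding it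
turns the difference of the two generating functions into a difference of second-order remainders,
which `errorTerm` bounds. -/
lemma HasIntensity.abs_integral_le (h : HasIntensity N Θ P) (hN : IsCountingProcess N)
    (hΘ : Measurable Θ) (hΘ_int : Integrable Θ P) {a b : ℝ≥0} (hab : a ≤ b) {Y : Ω → ℝ}
    (hY : Measurable[history N Θ (Set.Iic a)] Y) (hY0 : ∀ ω, 0 ≤ Y ω) (hY1 : ∀ ω, Y ω ≤ 1)
    {c : ℝ} (hc0 : 0 ≤ c) (hc1 : c ≤ 1) :
    |∫ ω, Y ω * ((1 - c) ^ (N b ω - N a ω) -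
        Real.exp (-(c * (((b : ℝ) - a) * (Θ ω).toNNReal)))) ∂P| ≤
      ∫ ω, errorTerm c (N b ω - N a ω) (((b : ℝ) - a) * (Θ ω).toNNReal) ∂P := by
  have hH : history N Θ (Set.Iic a) ≤ mΩ := history_le (fun u _ => hN.measurable u) hΘ
  have hYm : Measurable Y := hY.mono hH le_rfl
  have hYb : ∀ {f : Ω → ℝ}, Integrable f P → Integrable (fun ω => Y ω * f ω) P := fun hf =>
    hf.bdd_mul (c := 1) hYm.aestronglyMeasurable (Eventually.of_forall fun ω => by
      rw [Real.norm_of_nonneg (hY0 ω)]; exact hY1 ω)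
  set n : Ω → ℕ := fun ω => N b ω - N a ω with hn
  set x : Ω → ℝ := fun ω => ((b : ℝ) - a) * (Θ ω).toNNReal with hx
  have hnm : Measurable n := hN.measurable_sub a b
  have hxm : Measurable x := hΘ.real_toNNReal.coe_nnreal_real.const_mul _
  have hni : Integrable (fun ω => Y ω * (n ω : ℝ)) P := hYb (h.integrable_sub hN hΘ_int hab)
  have hxi : Integrable (fun ω => Y ω * x ω) P := hYb (hΘ_int.real_toNNReal.const_mul _)
  have hx0 : ∀ ω, 0 ≤ x ω := fun ω =>
    mul_nonneg (sub_nonneg.2 (NNReal.coe_le_coe.2 hab)) (NNReal.coe_nonneg _)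
  have hbal : ∫ ω, c * (Y ω * n ω - Y ω * x ω) ∂P = 0 := by
    rw [integral_const_mul, integral_sub hni hxi, h.integral_mul_sub hN hΘ hab hY hY0, sub_self,
      mul_zero]
  have hpi : Integrable (fun ω => Y ω * ((1 - c) ^ n ω - Real.exp (-(c * x ω)))) P := by
    refine hYb (Integrable.of_bound (C := 1) (Measurable.aestronglyMeasurable ?_)
      (Eventually.of_forall fun ω => ?_))
    · exact ((measurable_of_countable fun k : ℕ => (1 - c) ^ k).comp hnm).sub (by fun_prop)
    · exact abs_sub_le_of_nonneg_of_le (pow_nonneg (by linarith) _)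
        (pow_le_one₀ (by linarith) (by linarith)) (Real.exp_pos _).le
        (Real.exp_le_one_iff.2 (neg_nonpos.2 (mul_nonneg hc0 (hx0 ω))))
  have hdecomp : ∫ ω, Y ω * ((1 - c) ^ n ω - Real.exp (-(c * x ω))) ∂P =
      ∫ ω, Y ω * (((1 - c) ^ n ω - 1 + c * n ω) - (Real.exp (-(c * x ω)) - 1 + c * x ω)) ∂P := by
    have hbi : Integrable (fun ω => c * (Y ω * n ω - Y ω * x ω)) P := (hni.sub hxi).const_mul c
    rw [← add_zero (∫ ω, Y ω * ((1 - c) ^ n ω - Real.exp (-(c * x ω))) ∂P), ← hbal,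
      ← integral_add hpi hbi]
    congr 1
    funext ω
    ring
  rw [hdecomp, ← Real.norm_eq_abs]
  refine norm_integral_le_of_norm_le (h.integrable_errorTerm hN hΘ hΘ_int hab hc0)
    (Eventually.of_forall fun ω => ?_)
  rw [norm_mul, Real.norm_of_nonneg (hY0 ω)]
  refine (mul_le_of_le_one_left (norm_nonneg _) (hY1 ω)).trans ?_
  refine (norm_sub_le _ _).trans (add_le_add ?_ ?_)
  · rw [Real.norm_of_nonneg (one_sub_pow_sub_nonneg hc1 _)]
    exact one_sub_pow_sub_le hc0 hc1 _
  · rw [Real.norm_of_nonneg (exp_neg_sub_nonneg _)]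

/-- The `i`-th point of the partition of `[s, t]` into `k + 1` intervals of equal length. -/
noncomputable def partitionPoint (s t : ℝ≥0) (k i : ℕ) : ℝ≥0 := s + i * ((t - s) / (k + 1))

lemma partitionPoint_zero (s t : ℝ≥0) (k : ℕ) : partitionPoint s t k 0 = s := by
  simp [partitionPoint]

lemma partitionPoint_last {s t : ℝ≥0} (hst : s ≤ t) (k : ℕ) :
    partitionPoint s t k (k + 1) = t := by
  have : ((k : ℝ≥0) + 1) ≠ 0 := by positivity
  rw [partitionPoint, Nat.cast_add_one, mul_div_cancel₀ _ this, add_tsub_cancel_of_le hst]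

lemma partitionPoint_mono (s t : ℝ≥0) (k : ℕ) : Monotone (partitionPoint s t k) := by
  intro i j hij
  unfold partitionPoint
  gcongr

lemma partitionPoint_succ (s t : ℝ≥0) (k i : ℕ) :
    partitionPoint s t k (i + 1) = partitionPoint s t k i + (t - s) / (k + 1) := by
  simp only [partitionPoint, Nat.cast_add_one]
  ring

/-- The accumulated error over a partition of `[s, t]` tends to zero with the mesh. -/
lemma HasIntensity.tendsto_sum_integral_errorTerm (h : HasIntensity N Θ P)
    (hN : IsCountingProcess N) (hΘ : Measurable Θ) (hΘ_int : Integrable Θ P) {s t : ℝ≥0}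
    (hst : s ≤ t) {c : ℝ} (hc : 0 ≤ c) :
    Tendsto (fun k : ℕ => ∑ i ∈ Finset.range (k + 1), ∫ ω, errorTerm c
      (N (partitionPoint s t k (i + 1)) ω - N (partitionPoint s t k i) ω)
      (((partitionPoint s t k (i + 1) : ℝ) - partitionPoint s t k i) * (Θ ω).toNNReal) ∂P)
      atTop (𝓝 0) := by
  have hle : ∀ k i, partitionPoint s t k i ≤ partitionPoint s t k (i + 1) := fun k i =>
    partitionPoint_mono s t k i.le_succ
  have hint := fun k i => h.integrable_errorTerm hN hΘ hΘ_int (hle k i) hc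
  have hdiff : ∀ k i, (partitionPoint s t k (i + 1) : ℝ) - partitionPoint s t k i =
      ((t : ℝ) - s) / (k + 1) := fun k i => by
    rw [partitionPoint_succ, NNReal.coe_add, add_sub_cancel_left, NNReal.coe_div,
      NNReal.coe_sub hst]
    simp
  simp_rw [← integral_finsetSum _ fun i _ => hint _ i]
  rw [← integral_zero Ω ℝ (μ := P)]
  -- Bounding each error by `n + c x` and telescoping gives a dominating function independent of the
  -- partition.
  refine tendsto_integral_of_dominated_convergence
    (fun ω => ((N t ω - N s ω : ℕ) : ℝ) + c * (((t : ℝ) - s) * (Θ ω).toNNReal))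
    (fun k => (integrable_finsetSum _ fun i _ => hint k i).aestronglyMeasurable)
    ((h.integrable_sub hN hΘ_int hst).add ((hΘ_int.real_toNNReal.const_mul _).const_mul _))
    (fun k => Eventually.of_forall fun ω => ?_) (Eventually.of_forall fun ω => ?_)
  · rw [Real.norm_of_nonneg (Finset.sum_nonneg fun i _ => errorTerm_nonneg _ _ _)]
    have hmono := fun i => hN.mono ω (hle k i)
    refine (Finset.sum_le_sum fun i _ => errorTerm_le hc (mul_nonneg (sub_nonneg.2
      (NNReal.coe_le_coe.2 (hle k i))) (NNReal.coe_nonneg _)) _).trans (le_of_eq ?_)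
    rw [Finset.sum_add_distrib, ← Finset.mul_sum, ← Finset.sum_mul,
      Finset.sum_range_sub (fun i => (partitionPoint s t k i : ℝ)), partitionPoint_zero,
      partitionPoint_last hst, Nat.cast_sub (hN.mono ω hst)]
    have : ∀ i, ((N (partitionPoint s t k (i + 1)) ω - N (partitionPoint s t k i) ω : ℕ) : ℝ) =
        (N (partitionPoint s t k (i + 1)) ω : ℝ) - N (partitionPoint s t k i) ω := fun i =>
      Nat.cast_sub (hmono i)
    simp_rw [this]
    rw [Finset.sum_range_sub (fun i => (N (partitionPoint s t k i) ω : ℝ)), partitionPoint_zero,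
      partitionPoint_last hst]
  -- Pathwise, once the mesh is below the jump separation no interval holds two jumps. Only the
  -- exponential remainders survive: `k + 1` terms of size at most `(y / (k + 1)) ^ 2`.
  · obtain ⟨ε, hε, hjump⟩ := hN.exists_pos_forall_le_add_one t ω
    have hmesh : ∀ᶠ k : ℕ in atTop, ((t : ℝ) - s) / (k + 1) < ε := by
      have : Tendsto (fun k : ℕ => ((t : ℝ) - s) / (k + 1)) atTop (𝓝 0) := by
        have := (tendsto_one_div_add_atTop_nhds_zero_nat (𝕜 := ℝ)).const_mul ((t : ℝ) - s)
        simpa only [mul_one_div, mul_zero] using this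
      exact this.eventually_lt_const (NNReal.coe_pos.2 hε)
    set y : ℝ := c * (((t : ℝ) - s) * (Θ ω).toNNReal) with hy
    have hy0 : 0 ≤ y := mul_nonneg hc (mul_nonneg (sub_nonneg.2 (NNReal.coe_le_coe.2 hst))
      (NNReal.coe_nonneg _))
    have hlim : Tendsto (fun k : ℕ => y ^ 2 * (1 / ((k : ℝ) + 1))) atTop (𝓝 0) := by
      simpa using (tendsto_one_div_add_atTop_nhds_zero_nat (𝕜 := ℝ)).const_mul (y ^ 2)
    refine squeeze_zero' (Eventually.of_forall fun k =>
      Finset.sum_nonneg fun i _ => errorTerm_nonneg _ _ _) ?_ hlim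
    filter_upwards [hmesh] with k hk
    have hterm : ∀ i ∈ Finset.range (k + 1), errorTerm c
        (N (partitionPoint s t k (i + 1)) ω - N (partitionPoint s t k i) ω)
        (((partitionPoint s t k (i + 1) : ℝ) - partitionPoint s t k i) * (Θ ω).toNNReal) ≤
        (y / (k + 1)) ^ 2 := by
      intro i hi
      have h1 : partitionPoint s t k (i + 1) ≤ t := by
        conv_rhs => rw [← partitionPoint_last hst k]
        exact partitionPoint_mono s t k (Finset.mem_range.1 hi)
      have h2 : partitionPoint s t k (i + 1) < partitionPoint s t k i + ε := by
        rw [← NNReal.coe_lt_coe, NNReal.coe_add]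
        linarith [hdiff k i]
      have h3 := hjump _ _ (hle k i) h1 h2
      rw [errorTerm, if_neg (by omega), zero_add, hdiff]
      have h4 : c * (((t : ℝ) - s) / (k + 1) * (Θ ω).toNNReal) = y / (k + 1) := by
        rw [hy]; ring
      rw [h4]
      exact exp_neg_sub_le_sq (by positivity)
    refine (Finset.sum_le_sum hterm).trans (le_of_eq ?_)
    rw [Finset.sum_const, Finset.card_range, nsmul_eq_mul, Nat.cast_add_one]
    field_simp

/-- The generating function of the increments of `N` over the events of the history. -/
lemma HasIntensity.setIntegral_pow (h : HasIntensity N Θ P) (hN : IsCountingProcess N)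
    (hΘ : Measurable Θ) (hΘ_int : Integrable Θ P) {s t : ℝ≥0} (hst : s ≤ t) {c : ℝ}
    (hc0 : 0 ≤ c) (hc1 : c ≤ 1) {A : Set Ω} (hA : MeasurableSet[history N Θ (Set.Iic s)] A) :
    ∫ ω in A, (1 - c) ^ (N t ω - N s ω) ∂P =
      ∫ ω in A, Real.exp (-(c * (((t : ℝ) - s) * (Θ ω).toNNReal))) ∂P := by
  have hH : history N Θ (Set.Iic s) ≤ mΩ := history_le (fun u _ => hN.measurable u) hΘ
  have hpow : ∀ a b, Integrable (fun ω => (1 - c) ^ (N b ω - N a ω)) P := fun a b =>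
    Integrable.of_bound (C := 1) ((measurable_of_countable fun k : ℕ => (1 - c) ^ k).comp
      (hN.measurable_sub a b)).aestronglyMeasurable (Eventually.of_forall fun ω => by
        rw [Real.norm_of_nonneg (pow_nonneg (by linarith) _)]
        exact pow_le_one₀ (by linarith) (by linarith))
  have hexp : ∀ {a b : ℝ≥0}, a ≤ b → ∀ ω,
      Real.exp (-(c * (((b : ℝ) - a) * (Θ ω).toNNReal))) ≤ 1 := fun {a b} hab ω =>
    Real.exp_le_one_iff.2 (neg_nonpos.2 (mul_nonneg hc0 (mul_nonneg
      (sub_nonneg.2 (NNReal.coe_le_coe.2 hab)) (NNReal.coe_nonneg _))))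
  have hexpm : ∀ (a b : ℝ≥0) {m : MeasurableSpace Ω}, Measurable[m] Θ →
      Measurable[m] fun ω => Real.exp (-(c * (((b : ℝ) - a) * (Θ ω).toNNReal))) :=
    fun a b {m} hm => by fun_prop
  have hexpi : ∀ {a b : ℝ≥0}, a ≤ b →
      Integrable (fun ω => Real.exp (-(c * (((b : ℝ) - a) * (Θ ω).toNNReal)))) P := fun hab =>
    Integrable.of_bound (C := 1) (hexpm _ _ hΘ).aestronglyMeasurable
      (Eventually.of_forall fun ω => by
        rw [Real.norm_of_nonneg (Real.exp_pos _).le]; exact hexp hab ω)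
  rw [← sub_eq_zero, ← integral_sub (hpow s t).integrableOn (hexpi hst).integrableOn,
    ← abs_eq_zero]
  -- The difference does not depend on the partition, so bounding it by the accumulated error for
  -- every `k` makes it zero.
  refine le_antisymm (ge_of_tendsto' (h.tendsto_sum_integral_errorTerm hN hΘ hΘ_int hst hc0)
    fun k => ?_) (abs_nonneg _)
  set a := partitionPoint s t k with ha
  have hle : ∀ i, a i ≤ a (i + 1) := fun i => partitionPoint_mono s t k i.le_succ
  have hsa : ∀ i, s ≤ a i := fun i => by
    rw [← partitionPoint_zero s t k]; exact partitionPoint_mono s t k (Nat.zero_le i)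
  have hat : ∀ i ∈ Finset.range (k + 1), a (i + 1) ≤ t := fun i hi => by
    conv_rhs => rw [← partitionPoint_last hst k]
    exact partitionPoint_mono s t k (Finset.mem_range.1 hi)
  -- The interpolation weight: actual increments before `a i`, Poisson generating function after `a
  -- (i + 1)`. It is known at time `a i` because `Θ` belongs to every history. The `i`-th summand
  -- makes the exchange on the interval in between.
  set Y : ℕ → Ω → ℝ := fun i => A.indicator fun ω => (1 - c) ^ (N (a i) ω - N s ω) *
    Real.exp (-(c * (((t : ℝ) - a (i + 1)) * (Θ ω).toNNReal))) with hY
  have hYm : ∀ i, Measurable[history N Θ (Set.Iic (a i))] (Y i) := by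
    intro i
    have hNs : Measurable[history N Θ (Set.Iic (a i))] (N s) := measurable_history (hsa i)
    have hNa : Measurable[history N Θ (Set.Iic (a i))] (N (a i)) :=
      measurable_history (Set.mem_Iic.2 le_rfl)
    refine Measurable.indicator (Measurable.mul ?_ (hexpm _ _ measurable_history_param))
      (history_mono (Set.Iic_subset_Iic.2 (hsa i)) A hA)
    exact (measurable_of_countable fun p : ℕ × ℕ => (1 - c) ^ (p.1 - p.2)).comp
      (hNa.prodMk hNs)
  have hY0 : ∀ i ω, 0 ≤ Y i ω := fun i ω => Set.indicator_nonneg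
    (fun ω _ => mul_nonneg (pow_nonneg (by linarith) _) (Real.exp_pos _).le) ω
  have hY1 : ∀ i ∈ Finset.range (k + 1), ∀ ω, Y i ω ≤ 1 := fun i hi ω =>
    Set.indicator_apply_le' (fun _ => mul_le_one₀ (pow_le_one₀ (by linarith) (by linarith))
      (Real.exp_pos _).le (hexp (hat i hi) ω)) fun _ => zero_le_one
  have hYi : ∀ i ∈ Finset.range (k + 1), Integrable (fun ω => Y i ω *
      ((1 - c) ^ (N (a (i + 1)) ω - N (a i) ω) -
        Real.exp (-(c * (((a (i + 1) : ℝ) - a i) * (Θ ω).toNNReal))))) P := fun i hi =>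
    ((hpow _ _).sub (hexpi (hle i))).bdd_mul (c := 1)
      ((hYm i).mono (history_le (fun u _ => hN.measurable u) hΘ) le_rfl).aestronglyMeasurable
      (Eventually.of_forall fun ω => by rw [Real.norm_of_nonneg (hY0 i ω)]; exact hY1 i hi ω)
  have htel : ∀ ω, A.indicator (fun ω => (1 - c) ^ (N t ω - N s ω) -
      Real.exp (-(c * (((t : ℝ) - s) * (Θ ω).toNNReal)))) ω =
      ∑ i ∈ Finset.range (k + 1), Y i ω * ((1 - c) ^ (N (a (i + 1)) ω - N (a i) ω) -
        Real.exp (-(c * (((a (i + 1) : ℝ) - a i) * (Θ ω).toNNReal)))) := by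
    intro ω
    by_cases hω : ω ∈ A
    · have hz := Finset.sum_range_sub (fun i => (1 - c) ^ (N (a i) ω - N s ω) *
        Real.exp (-(c * (((t : ℝ) - a i) * (Θ ω).toNNReal)))) (k + 1)
      have h0 : a 0 = s := partitionPoint_zero s t k
      have h1 : a (k + 1) = t := partitionPoint_last hst k
      simp only [h0, h1, sub_self, zero_mul, mul_zero, neg_zero, Real.exp_zero, mul_one,
        Nat.sub_self, pow_zero, one_mul] at hz
      rw [Set.indicator_of_mem hω, ← hz]
      refine Finset.sum_congr rfl fun i _ => ?_
      simp only [hY, Set.indicator_of_mem hω]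
      have e1 : N (a (i + 1)) ω - N s ω =
          (N (a i) ω - N s ω) + (N (a (i + 1)) ω - N (a i) ω) := by
        have m1 : N s ω ≤ N (a i) ω := hN.mono ω (hsa i)
        have m2 : N (a i) ω ≤ N (a (i + 1)) ω := hN.mono ω (hle i)
        omega
      have e2 : -(c * (((t : ℝ) - a i) * (Θ ω).toNNReal)) =
          -(c * (((t : ℝ) - a (i + 1)) * (Θ ω).toNNReal)) +
            -(c * (((a (i + 1) : ℝ) - a i) * (Θ ω).toNNReal)) := by ring
      rw [e1, e2, Real.exp_add, pow_add]
      ring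
    · rw [Set.indicator_of_notMem hω]
      refine (Finset.sum_eq_zero fun i _ => ?_).symm
      simp only [hY, Set.indicator_of_notMem hω, zero_mul]
  rw [← integral_indicator (hH A hA), integral_congr_ae (Eventually.of_forall htel),
    integral_finsetSum _ hYi]
  refine (Finset.abs_sum_le_sum_abs _ _).trans (Finset.sum_le_sum fun i hi => ?_)
  exact h.abs_integral_le hN hΘ hΘ_int (hle i) (hYm i) (hY0 i) (hY1 i hi) hc0 hc1

lemma measurable_poissonMeasure_apply (n : Set ℕ) :
    Measurable fun r : ℝ≥0 => poissonMeasure r n := by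
  simp_rw [poissonMeasure, Measure.sum_apply _ (MeasurableSet.of_discrete (s := n)),
    Measure.smul_apply, smul_eq_mul]
  exact Measurable.tsum fun k => Measurable.mul_const (by fun_prop) _

/-- **Watanabe's theorem**, for mixed Poisson processes: a counting process with intensity `Θ` has
conditionally Poisson increments. -/
lemma HasIntensity.hasPoissonIncrements (h : HasIntensity N Θ P) (hN : IsCountingProcess N)
    (hΘ : Measurable Θ) (hΘ_int : Integrable Θ P) : HasPoissonIncrements N Θ P := by
  intro s t hst A hA n
  have hH : history N Θ (Set.Iic s) ≤ mΩ := history_le (fun u _ => hN.measurable u) hΘ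
  have hAm := hH A hA
  have hnm := hN.measurable_sub s t
  have hpm : ∀ n, Measurable fun ω => poissonMeasure ((t - s) * (Θ ω).toNNReal) {n} := fun n =>
    (measurable_poissonMeasure_apply {n}).comp (hΘ.real_toNNReal.const_mul _)
  refine eq_of_tsum_ofReal_pow_mul_eq (a := fun n => P (A ∩ {ω | N t ω - N s ω = n}))
    (b := fun n => ∫⁻ ω in A, poissonMeasure ((t - s) * (Θ ω).toNNReal) {n} ∂P)
    (fun n => prob_le_one) (fun n => ?_) (fun z hz hz1 => ?_) n
  · calc _ ≤ ∫⁻ ω in A, 1 ∂P := lintegral_mono fun ω => prob_le_one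
      _ ≤ 1 := by simpa using prob_le_one
  -- With `c = 1 - z` the powers become `z ^ n`, and both sums are generating functions at `z`.
  · have hgen := h.setIntegral_pow hN hΘ hΘ_int hst.le (c := 1 - z) (by linarith) (by linarith) hA
    rw [sub_sub_cancel] at hgen
    have hl : ∑' n, ENNReal.ofReal (z ^ n) * P (A ∩ {ω | N t ω - N s ω = n}) =
        ∫⁻ ω in A, ENNReal.ofReal (z ^ (N t ω - N s ω)) ∂P := by
      rw [← lintegral_map (f := fun n : ℕ => ENNReal.ofReal (z ^ n))
        (measurable_of_countable _) hnm, lintegral_countable']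
      refine tsum_congr fun n => ?_
      rw [Measure.map_apply hnm (measurableSet_singleton n),
        Measure.restrict_apply (hnm (measurableSet_singleton n)), Set.inter_comm]
      rfl
    have hr : ∑' n, ENNReal.ofReal (z ^ n) *
        ∫⁻ ω in A, poissonMeasure ((t - s) * (Θ ω).toNNReal) {n} ∂P =
        ∫⁻ ω in A, ENNReal.ofReal
          (Real.exp (-((1 - z) * (((t : ℝ) - s) * (Θ ω).toNNReal)))) ∂P := by
      simp_rw [← lintegral_const_mul _ (hpm _)]
      rw [← lintegral_tsum fun n => ((hpm n).const_mul _).aemeasurable]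
      refine lintegral_congr fun ω => ?_
      rw [tsum_ofReal_pow_mul_poissonMeasure _ hz.le, NNReal.coe_mul, NNReal.coe_sub hst.le]
    rw [hl, hr, ← ofReal_integral_eq_lintegral_ofReal, ← ofReal_integral_eq_lintegral_ofReal, hgen]
    · refine Integrable.of_bound (C := 1) (by fun_prop) (Eventually.of_forall fun ω => ?_)
      rw [Real.norm_of_nonneg (Real.exp_pos _).le, Real.exp_le_one_iff, neg_nonpos]
      exact mul_nonneg (by linarith) (mul_nonneg (sub_nonneg.2 (NNReal.coe_le_coe.2 hst.le))
        (NNReal.coe_nonneg _))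
    · exact Eventually.of_forall fun ω => (Real.exp_pos _).le
    · refine Integrable.of_bound (C := 1)
        ((measurable_of_countable fun n : ℕ => z ^ n).comp hnm).aestronglyMeasurable
        (Eventually.of_forall fun ω => ?_)
      rw [Real.norm_of_nonneg (by positivity)]
      exact pow_le_one₀ hz.le hz1.le
    · exact Eventually.of_forall fun ω => pow_nonneg hz.le _

end Watanabe

/-! ### Conditional probabilities and the Poisson mean -/

section CondExp

variable {Ω : Type*}

/-- Passes from extended-integral identities on events of `m` to conditional probabilities, by the
defining property of conditional expectation. -/
lemma condExp_indicator_ae_eq {m mΩ : MeasurableSpace Ω} {P : Measure Ω} [IsProbabilityMeasure P]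
    (hm : m ≤ mΩ) {D : Set Ω} (hD : MeasurableSet D) {q : Ω → ℝ≥0∞} (hq : Measurable[m] q)
    (hq1 : ∀ ω, q ω ≤ 1) (h : ∀ F, MeasurableSet[m] F → P (F ∩ D) = ∫⁻ ω in F, q ω ∂P) :
    P⟦D|m⟧ =ᵐ[P] fun ω => (q ω).toReal := by
  have hq' : Measurable q := hq.mono hm le_rfl
  have hlt : ∀ ω, q ω < ∞ := fun ω => (hq1 ω).trans_lt ENNReal.one_lt_top
  symm
  refine ae_eq_condExp_of_forall_setIntegral_eq hm ((integrable_const _).indicator hD)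
    (fun F _ _ => ?_) (fun F hF _ => ?_) hq.ennreal_toReal.aestronglyMeasurable
  · refine (Integrable.of_bound (C := 1) hq'.ennreal_toReal.aestronglyMeasurable
      (Filter.Eventually.of_forall fun ω => ?_)).integrableOn
    rw [Real.norm_of_nonneg ENNReal.toReal_nonneg]
    exact ENNReal.toReal_le_of_le_ofReal zero_le_one (by simpa using hq1 ω)
  · rw [integral_toReal hq'.aemeasurable (Filter.Eventually.of_forall hlt), ← h F hF,
      integral_indicator_const _ hD, measureReal_restrict_apply hD, smul_eq_mul, mul_one,
      Set.inter_comm, measureReal_def]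

end CondExp

/-- The factor `n` cancels into `n!`; after an index shift, `r` times the total mass remains. -/
lemma tsum_natCast_mul_poissonMeasure (r : ℝ≥0) :
    ∑' n : ℕ, (n : ℝ≥0∞) * poissonMeasure r {n} = r := by
  have hs : HasSum (fun n : ℕ => (n : ℝ) * (Real.exp (-r) * r ^ n / n.factorial)) r := by
    have h1 : HasSum (fun n : ℕ => ((n + 1 : ℕ) : ℝ) *
        (Real.exp (-r) * r ^ (n + 1) / (n + 1).factorial)) r := by
      have := (hasSum_one_poissonMeasure r).mul_left (r : ℝ)
      rw [mul_one] at this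
      refine this.congr_fun fun n => ?_
      rw [Nat.factorial_succ, Nat.cast_mul, pow_succ]
      have : ((n + 1 : ℕ) : ℝ) ≠ 0 := by positivity
      field_simp
    rw [hasSum_nat_add_iff (f := fun n : ℕ => (n : ℝ) * (Real.exp (-r) * r ^ n / n.factorial)) 1]
      at h1
    simpa using h1
  rw [← ENNReal.ofReal_coe_nnreal (p := r), ← hs.tsum_eq,
    ENNReal.ofReal_tsum_of_nonneg (fun n => by positivity) hs.summable]
  refine tsum_congr fun n => ?_
  rw [poissonMeasure_singleton, ENNReal.ofReal_mul (by positivity), ENNReal.ofReal_natCast]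

/-! ### Joint law of the increments given `Θ` -/

section Increments

variable {Ω : Type*} [mΩ : MeasurableSpace Ω] {P : Measure Ω} {N : ℝ≥0 → Ω → ℕ} {Θ : Ω → ℝ}

lemma measurable_poissonMeasure_param {Ω : Type*} {m : MeasurableSpace Ω} {Θ : Ω → ℝ} (hΘ : Measurable[m] Θ)
    (c : ℝ≥0) (B : Set ℕ) :
    Measurable[m] fun ω => poissonMeasure (c * (Θ ω).toNNReal) B :=
  (measurable_poissonMeasure_apply B).comp (hΘ.real_toNNReal.const_mul _)

lemma HasPoissonIncrements.hasIntensity (h : HasPoissonIncrements N Θ P)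
    (hN : IsCountingProcess N) (hΘ : Measurable Θ) : HasIntensity N Θ P := by
  intro s t hst A hA
  rcases hst.eq_or_lt with rfl | hlt
  · simp
  have hnm := hN.measurable_sub s t
  have hpm := fun n => measurable_poissonMeasure_param hΘ (t - s) {n}
  rw [← lintegral_map (f := fun n : ℕ => (n : ℝ≥0∞)) (measurable_of_countable _) hnm,
    lintegral_countable']
  have hterm : ∀ n : ℕ, (n : ℝ≥0∞) * (Measure.map (fun ω => N t ω - N s ω) (P.restrict A)) {n} =
      ∫⁻ ω in A, n * poissonMeasure ((t - s) * (Θ ω).toNNReal) {n} ∂P := by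
    intro n
    rw [lintegral_const_mul _ (hpm n), Measure.map_apply hnm (measurableSet_singleton n),
      Measure.restrict_apply (hnm (measurableSet_singleton n)), Set.inter_comm, ← h s t hlt A hA n]
    rfl
  simp_rw [hterm]
  rw [← lintegral_tsum fun n => ((hpm n).const_mul _).aemeasurable]
  refine lintegral_congr fun ω => ?_
  rw [tsum_natCast_mul_poissonMeasure, ← NNReal.coe_sub hst,
    ENNReal.ofReal_mul (NNReal.coe_nonneg _), ENNReal.ofReal_coe_nnreal, ENNReal.coe_mul]
  rfl

/-- The vector of the increments of `N` along the times `t`. -/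
def increments {Ω : Type*} (N : ℝ≥0 → Ω → ℕ) {m : ℕ} (t : Fin (m + 1) → ℝ≥0) (ω : Ω) :
    Fin m → ℕ :=
  fun j => N (t j.succ) ω - N (t j.castSucc) ω

lemma measurable_increments {Ω : Type*} {m : MeasurableSpace Ω} {N : ℝ≥0 → Ω → ℕ} {k : ℕ}
    {t : Fin (k + 1) → ℝ≥0} (hN : ∀ j, Measurable[m] (N (t j))) :
    Measurable[m] (increments N t) :=
  measurable_pi_lambda _ fun j => (measurable_of_countable (fun n : ℕ × ℕ => n.1 - n.2)).comp
    ((hN j.succ).prodMk (hN j.castSucc))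

/-- As `Θ` belongs to every history, the defining identity extends to weights `g(Θ)`. These carry
the Poisson factors already split off in the induction over several increments. -/
lemma HasPoissonIncrements.setLIntegral_inter (h : HasPoissonIncrements N Θ P)
    (hN : IsCountingProcess N) (hΘ : Measurable Θ) {s t : ℝ≥0} (hst : s < t) {E : Set Ω}
    (hE : MeasurableSet[history N Θ (Set.Iic s)] E) (n : ℕ) {g : ℝ → ℝ≥0∞} (hg : Measurable g) :
    ∫⁻ ω in E ∩ {ω | N t ω - N s ω = n}, g (Θ ω) ∂P =
      ∫⁻ ω in E, g (Θ ω) * poissonMeasure ((t - s) * (Θ ω).toNNReal) {n} ∂P := by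
  have hH : history N Θ (Set.Iic s) ≤ mΩ := history_le (fun u _ => hN.measurable u) hΘ
  have hD : MeasurableSet {ω | N t ω - N s ω = n} :=
    hN.measurable_sub s t (measurableSet_singleton n)
  have key := lintegral_mul_eq_of_forall_setLIntegral_eq (P := P) hH
    (f := {ω | N t ω - N s ω = n}.indicator fun _ => 1)
    (g := fun ω => poissonMeasure ((t - s) * (Θ ω).toNNReal) {n})
    (Y := E.indicator fun ω => g (Θ ω)) (measurable_const.indicator hD)
    (measurable_poissonMeasure_param hΘ _ _) (fun A hA => ?_)
    ((hg.comp measurable_history_param).indicator hE)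
  · rw [← lintegral_indicator ((hH E hE).inter hD), ← lintegral_indicator (hH E hE)]
    refine (lintegral_congr fun ω => ?_).trans (key.trans (lintegral_congr fun ω => ?_))
    · by_cases h1 : ω ∈ E <;> by_cases h2 : N t ω - N s ω = n <;> simp [h1, h2]
    · by_cases h1 : ω ∈ E <;> simp [h1]
  · rw [lintegral_indicator_const hD, one_mul, Measure.restrict_apply hD, Set.inter_comm,
      h s t hst A hA n]

lemma HasPoissonIncrements.setLIntegral_increments (h : HasPoissonIncrements N Θ P)
    (hN : IsCountingProcess N) (hΘ : Measurable Θ) {m : ℕ} (t : Fin (m + 1) → ℝ≥0)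
    (ht : StrictMono t) (n : Fin m → ℕ) {A : Set Ω}
    (hA : MeasurableSet[history N Θ (Set.Iic (t 0))] A) {g : ℝ → ℝ≥0∞} (hg : Measurable g) :
    ∫⁻ ω in A ∩ {ω | increments N t ω = n}, g (Θ ω) ∂P =
      ∫⁻ ω in A, g (Θ ω) *
        ∏ j, poissonMeasure ((t j.succ - t j.castSucc) * (Θ ω).toNNReal) {n j} ∂P := by
  induction m generalizing g with
  | zero =>
    have : {ω | increments N t ω = n} = Set.univ := by
      ext ω
      simp [eq_iff_true_of_subsingleton]
    simp [this]
  | succ m ih =>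
    -- The last increment is split off: the earlier ones lie in the history at its left endpoint,
    -- and its Poisson factor is absorbed into `g`.
    have hsplit : A ∩ {ω | increments N t ω = n} =
        (A ∩ {ω | increments N (fun j => t j.castSucc) ω = fun j => n j.castSucc}) ∩
          {ω | N (t (Fin.last m).succ) ω - N (t (Fin.last m).castSucc) ω = n (Fin.last m)} := by
      ext ω
      simp only [Set.mem_inter_iff, Set.mem_ofPred_eq, funext_iff, Fin.forall_fin_succ', and_assoc,
        increments, Fin.succ_castSucc]
    have hlt : t (Fin.last m).castSucc < t (Fin.last m).succ := ht Fin.castSucc_lt_succ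
    have hmeas : MeasurableSet[history N Θ (Set.Iic (t (Fin.last m).castSucc))]
        (A ∩ {ω | increments N (fun j => t j.castSucc) ω = fun j => n j.castSucc}) := by
      refine MeasurableSet.inter (history_mono (Set.Iic_subset_Iic.2
        (ht.monotone (Fin.zero_le _))) A hA) ?_
      refine measurable_increments (fun j => measurable_history ?_) (measurableSet_singleton _)
      exact ht.monotone (Fin.castSucc_le_castSucc_iff.2 (Fin.le_last j))
    rw [hsplit, h.setLIntegral_inter hN hΘ hlt hmeas _ hg]
    rw [ih (fun j => t j.castSucc) (ht.comp Fin.strictMono_castSucc) (fun j => n j.castSucc) hA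
      (g := fun x => g x * poissonMeasure ((t (Fin.last m).succ - t (Fin.last m).castSucc) *
        x.toNNReal) {n (Fin.last m)})
      (hg.mul (measurable_poissonMeasure_param measurable_id _ _))]
    refine lintegral_congr fun ω => ?_
    rw [Fin.prod_univ_castSucc]
    simp only [Fin.succ_castSucc]
    ring

/-- The conditional law of the vector of increments given `Θ` is a product of Poisson laws. -/
lemma HasPoissonIncrements.measure_inter_increments [IsProbabilityMeasure P]
    (h : HasPoissonIncrements N Θ P)
    (hN : IsCountingProcess N) (hΘ : Measurable Θ) {m : ℕ} (t : Fin (m + 1) → ℝ≥0)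
    (ht : StrictMono t) {F : Set Ω} (hF : MeasurableSet[sigmaOf Θ] F) (B : Set (Fin m → ℕ)) :
    P (F ∩ increments N t ⁻¹' B) = ∫⁻ ω in F,
      Measure.pi (fun j => poissonMeasure ((t j.succ - t j.castSucc) * (Θ ω).toNNReal)) B ∂P := by
  have hΔ : Measurable (increments N t) := measurable_increments fun j => hN.measurable _
  have hB : MeasurableSet B := MeasurableSet.of_discrete
  have hF' : MeasurableSet[history N Θ (Set.Iic (t 0))] F :=
    (le_sup_right : sigmaOf Θ ≤ history N Θ (Set.Iic (t 0))) F hF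
  have hpm : ∀ n : Fin m → ℕ, Measurable fun ω =>
      B.indicator (fun n => ∏ j, poissonMeasure ((t j.succ - t j.castSucc) * (Θ ω).toNNReal) {n j})
        n := by
    intro n
    by_cases hn : n ∈ B
    · simp only [hn, Set.indicator_of_mem]
      exact Finset.measurable_prod _ fun j _ => measurable_poissonMeasure_param hΘ _ _
    · simp only [hn, not_false_eq_true, Set.indicator_of_notMem, measurable_const]
  have hpi : ∀ ω, Measure.pi (fun j => poissonMeasure ((t j.succ - t j.castSucc) *
      (Θ ω).toNNReal)) B = ∑' n : Fin m → ℕ, B.indicator (fun n => ∏ j,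
        poissonMeasure ((t j.succ - t j.castSucc) * (Θ ω).toNNReal) {n j}) n := by
    intro ω
    rw [← Measure.tsum_indicator_apply_singleton _ _ hB]
    simp_rw [Measure.pi_singleton]
  simp_rw [hpi]
  rw [lintegral_tsum fun n => (hpm n).aemeasurable, Set.inter_comm,
    ← Measure.restrict_apply (hΔ hB), ← Measure.map_apply hΔ hB,
    ← Measure.tsum_indicator_apply_singleton _ _ hB]
  refine tsum_congr fun n => ?_
  by_cases hn : n ∈ B
  · simp only [hn, Set.indicator_of_mem]
    rw [Measure.map_apply hΔ (measurableSet_singleton n),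
      Measure.restrict_apply (hΔ (measurableSet_singleton n)), Set.inter_comm]
    have := h.setLIntegral_increments hN hΘ t ht n hF' (g := fun _ => 1) measurable_const
    simp only [lintegral_one, Measure.restrict_apply_univ, one_mul] at this
    exact this
  · simp [hn]

variable [IsProbabilityMeasure P]

lemma HasPoissonIncrements.condExp_increments (h : HasPoissonIncrements N Θ P)
    (hN : IsCountingProcess N) (hΘ : Measurable Θ) {m : ℕ} (t : Fin (m + 1) → ℝ≥0)
    (ht : StrictMono t) (s : Finset (Fin m)) (D : Fin m → Set ℕ) :
    P⟦⋂ j ∈ s, {ω | increments N t ω j ∈ D j}|sigmaOf Θ⟧ =ᵐ[P] fun ω => ∏ j ∈ s,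
      (poissonMeasure ((t j.succ - t j.castSucc) * (Θ ω).toNNReal)).real (D j) := by
  have hΔ : Measurable (increments N t) := measurable_increments fun j => hN.measurable _
  -- Coordinates outside `s` are unconstrained and contribute mass one to the product law.
  set B : Set (Fin m → ℕ) := Set.pi Set.univ fun j => if j ∈ s then D j else Set.univ with hB
  have hset : ⋂ j ∈ s, {ω | increments N t ω j ∈ D j} = increments N t ⁻¹' B := by
    ext ω
    simp only [Set.mem_iInter, Set.mem_ofPred_eq, hB, Set.mem_preimage, Set.mem_univ_pi]
    refine forall_congr' fun j => ?_
    split_ifs with hj <;> simp [hj]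
  have hpi : ∀ ω, Measure.pi (fun j => poissonMeasure ((t j.succ - t j.castSucc) *
      (Θ ω).toNNReal)) B = ∏ j ∈ s,
        poissonMeasure ((t j.succ - t j.castSucc) * (Θ ω).toNNReal) (D j) := by
    intro ω
    rw [hB, Measure.pi_pi, ← Finset.prod_subset (Finset.subset_univ s)]
    · exact Finset.prod_congr rfl fun j hj => by rw [if_pos hj]
    · intro j _ hj
      rw [if_neg hj, measure_univ]
  have hthm := condExp_indicator_ae_eq (P := P) hΘ.comap_le (hΔ (MeasurableSet.of_discrete (s := B)))
    (q := fun ω => ∏ j ∈ s, poissonMeasure ((t j.succ - t j.castSucc) * (Θ ω).toNNReal) (D j))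
    (Finset.measurable_prod _ fun j _ =>
      measurable_poissonMeasure_param (comap_measurable Θ) _ _)
    (fun ω => Finset.prod_le_one' fun j _ => prob_le_one) (fun F hF => by
      rw [h.measure_inter_increments hN hΘ t ht hF B]
      simp_rw [hpi])
  rw [hset]
  filter_upwards [hthm] with ω hω
  rw [hω, ENNReal.toReal_prod]
  rfl

lemma IsCountingProcess.cast_increments (hN : IsCountingProcess N) {m : ℕ}
    {t : Fin (m + 1) → ℝ≥0} (ht : StrictMono t) (ω : Ω) (j : Fin m) :
    (increments N t ω j : ℝ) = N (t j.succ) ω - N (t j.castSucc) ω :=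
  Nat.cast_sub (hN.mono ω (ht Fin.castSucc_lt_succ).le)

lemma HasPoissonIncrements.isMPP (h : HasPoissonIncrements N Θ P)
    (hN : IsCountingProcess N) (hΘ : Measurable Θ) : IsMPP N Θ P where
  condIndepIncrements := by
    intro m t ht s A hA
    choose! C hC hCA using hA
    have hset : ∀ j ∈ s, A j = {ω | increments N t ω j ∈ (Nat.cast ⁻¹' C j : Set ℕ)} := by
      intro j hj
      rw [← hCA j hj]
      ext ω
      simp [hN.cast_increments ht]
    have h1 := h.condExp_increments hN hΘ t ht s fun j => Nat.cast ⁻¹' C j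
    have h2 : ∀ᵐ ω ∂P, ∀ j ∈ s, (P⟦A j|sigmaOf Θ⟧) ω =
        (poissonMeasure ((t j.succ - t j.castSucc) * (Θ ω).toNNReal)).real (Nat.cast ⁻¹' C j) := by
      rw [Finset.eventually_all]
      intro j hj
      -- A one-element index set gives the marginal conditional probabilities, to be compared with
      -- the joint one.
      have := h.condExp_increments hN hΘ t ht {j} fun j => Nat.cast ⁻¹' C j
      filter_upwards [this] with ω hω
      simpa [hset j hj] using hω
    rw [Set.iInter₂_congr hset]
    filter_upwards [h1, h2] with ω h1 h2
    rw [h1]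
    exact (Finset.prod_congr rfl h2).symm
  condStationaryIncrements := by
    intro m t k ht F B hF hB
    have ht' : StrictMono fun j => t j + k := fun i j hij => by
      simpa using ht hij
    have hset : ∀ u : Fin (m + 1) → ℝ≥0, StrictMono u →
        {ω | (fun j : Fin m => (N (u j.succ) ω : ℝ) - N (u j.castSucc) ω) ∈ B} =
          increments N u ⁻¹' {n | (fun j => (n j : ℝ)) ∈ B} := by
      intro u hu
      ext ω
      simp [hN.cast_increments hu]
    rw [hset _ ht, hset _ ht', h.measure_inter_increments hN hΘ _ ht hF,
      h.measure_inter_increments hN hΘ _ ht' hF]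
    simp_rw [add_tsub_add_eq_tsub_right]
  poisson := by
    intro t ht
    -- `N_t` is the increment over `[0, t]`. Laws on `ℕ` are compared on singletons, with one null
    -- set for each of countably many.
    have hn : ∀ n : ℕ, ∀ᵐ ω ∂P, condDistrib (N t) Θ P (Θ ω) {n} =
        poissonMeasure (t * (Θ ω).toNNReal) {n} := by
      intro n
      have h1 := condDistrib_ae_eq_condExp (μ := P) hΘ (hN.measurable t)
        (measurableSet_singleton n)
      have h2 := condExp_indicator_ae_eq (P := P) hΘ.comap_le
        (hN.measurable t (measurableSet_singleton n))
        (q := fun ω => poissonMeasure (t * (Θ ω).toNNReal) {n})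
        (measurable_poissonMeasure_param (comap_measurable Θ) _ _)
        (fun ω => prob_le_one) (fun F hF => by
          have := h 0 t ht F ((le_sup_right : sigmaOf Θ ≤ history N Θ (Set.Iic 0)) F hF) n
          simp only [hN.zero, tsub_zero] at this
          exact this)
      filter_upwards [h1, h2] with ω h1 h2
      rw [← ENNReal.toReal_eq_toReal_iff' (by finiteness) (by finiteness), ← h2, ← h1]
      rfl
    filter_upwards [ae_all_iff.2 hn] with ω hω
    exact Measure.ext_of_singleton hω

end Increments

/-! ### From mixed Poisson processes to Poisson increments -/

section MixedPoisson

variable {Ω : Type*} [mΩ : MeasurableSpace Ω] {P : Measure Ω} [IsProbabilityMeasure P]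
  {N : ℝ≥0 → Ω → ℕ} {X : ℕ → Ω → ℝ} {Θ : Ω → ℝ}

/-- The conditional law of one increment of a mixed Poisson process. -/
lemma IsMPP.measure_inter_sub (h : IsMPP N Θ P) (hN : IsCountingProcess N) (hΘ : Measurable Θ)
    {s t : ℝ≥0} (hst : s < t) (n : ℕ) {F : Set Ω} (hF : MeasurableSet[sigmaOf Θ] F) :
    P (F ∩ {ω | N t ω - N s ω = n}) =
      ∫⁻ ω in F, poissonMeasure ((t - s) * (Θ ω).toNNReal) {n} ∂P := by
  have hpos : 0 < t - s := tsub_pos_of_lt hst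
  have hmono : StrictMono ![0, t - s] := by
    intro i j hij
    fin_cases i <;> fin_cases j <;> simp_all
  -- Stationarity moves the increment over `[s, t]` to `[0, t - s]`, where it equals `N_{t - s}` and
  -- its conditional law is known.
  have hstat := h.condStationaryIncrements 1 ![0, t - s] s hmono F {x | x 0 = n} hF
    (measurable_pi_apply 0 (measurableSet_singleton _))
  have e1 : {ω | N t ω - N s ω = n} = {ω | (fun j : Fin 1 =>
      ((N (![0, t - s] j.succ + s) ω : ℝ) - N (![0, t - s] j.castSucc + s) ω)) ∈
        {x : Fin 1 → ℝ | x 0 = n}} := by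
    ext ω
    have hle : N s ω ≤ N t ω := hN.mono ω hst.le
    simp [tsub_add_cancel_of_le hst.le, ← Nat.cast_sub hle]
  have e2 : {ω | (fun j : Fin 1 =>
      ((N (![0, t - s] j.succ) ω : ℝ) - N (![0, t - s] j.castSucc) ω)) ∈
        {x : Fin 1 → ℝ | x 0 = n}} = N (t - s) ⁻¹' {n} := by
    ext ω
    simp [hN.zero]
  rw [e1, hstat, e2, ← setLIntegral_condDistrib_of_measurableSet hΘ
    (hN.measurable _).aemeasurable (measurableSet_singleton n) hF]
  refine setLIntegral_congr_fun_ae (hΘ.comap_le F hF) ?_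
  filter_upwards [h.poisson _ hpos] with ω hω _
  rw [hω]

lemma strictMono_snoc {m : ℕ} {e : Fin (m + 1) → ℝ≥0} (he : StrictMono e) {t : ℝ≥0}
    (ht : e (Fin.last m) < t) : StrictMono (Fin.snoc e t : Fin (m + 2) → ℝ≥0) := by
  rw [Fin.strictMono_iff_lt_succ]
  intro i
  induction i using Fin.lastCases with
  | last => simpa using ht
  | cast j =>
    rw [Fin.succ_castSucc, Fin.snoc_castSucc (α := fun _ => ℝ≥0),
      Fin.snoc_castSucc (α := fun _ => ℝ≥0)]
    exact he Fin.castSucc_lt_succ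

/-- Given `Θ`, the next increment is independent of the earlier ones, so the conditional probability
of the joint event is that of the earlier ones times a Poisson weight. The weight is a function of
`Θ`, hence may be moved inside the conditional expectation and integrated over the event. -/
lemma IsMPP.measure_inter_increments_eq (h : IsMPP N Θ P) (hN : IsCountingProcess N)
    (hΘ : Measurable Θ) {m : ℕ} {e : Fin (m + 1) → ℝ≥0} (he : StrictMono e) {t : ℝ≥0}
    (ht : e (Fin.last m) < t) (n : ℕ) {F : Set Ω} (hF : MeasurableSet[sigmaOf Θ] F)
    (v : Fin m → ℕ) :
    P (F ∩ {ω | increments N e ω = v} ∩ {ω | N t ω - N (e (Fin.last m)) ω = n}) =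
      ∫⁻ ω in F ∩ {ω | increments N e ω = v},
        poissonMeasure ((t - e (Fin.last m)) * (Θ ω).toNNReal) {n} ∂P := by
  set s := e (Fin.last m) with hs
  set U : Set Ω := {ω | increments N e ω = v} with hU
  set D : Set Ω := {ω | N t ω - N s ω = n} with hD
  have hFm : MeasurableSet F := hΘ.comap_le F hF
  have hUm : MeasurableSet U :=
    measurable_increments (fun j => hN.measurable _) (measurableSet_singleton v)
  have hDm : MeasurableSet D := hN.measurable_sub s t (measurableSet_singleton n)
  set q : Ω → ℝ≥0∞ := fun ω => poissonMeasure ((t - s) * (Θ ω).toNNReal) {n} with hq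
  have hqm : Measurable[sigmaOf Θ] q := measurable_poissonMeasure_param (comap_measurable Θ) _ _
  have hqm' : Measurable q := hqm.mono hΘ.comap_le le_rfl
  have hq1 : ∀ ω, q ω ≤ 1 := fun ω => prob_le_one
  have hqlt : ∀ ω, q ω < ∞ := fun ω => (hq1 ω).trans_lt ENNReal.one_lt_top
  have hqb : ∀ ω, ‖(q ω).toReal‖ ≤ 1 := fun ω => by
    rw [Real.norm_of_nonneg ENNReal.toReal_nonneg]
    exact ENNReal.toReal_le_of_le_ofReal zero_le_one (by simpa using hq1 ω)
  have hcD : P⟦D|sigmaOf Θ⟧ =ᵐ[P] fun ω => (q ω).toReal :=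
    condExp_indicator_ae_eq hΘ.comap_le hDm hqm hq1 fun F hF =>
      h.measure_inter_sub hN hΘ ht n hF
  set A : Fin m → Set Ω := fun j => {ω | N (e j.succ) ω - N (e j.castSucc) ω = v j} with hA
  have hcast : ∀ {a b : ℝ≥0}, a ≤ b → ∀ k : ℕ, {ω | N b ω - N a ω = k} =
      (fun ω => (N b ω : ℝ) - N a ω) ⁻¹' {(k : ℝ)} := fun hab k => by
    ext ω
    have := hN.mono ω hab
    simp [← Nat.cast_sub this]
  -- The case `E = univ` recombines the product over the earlier increments into the conditional
  -- probability of `U`.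
  have hind : ∀ E : Set Ω, (E = D ∨ E = Set.univ) → P⟦U ∩ E|sigmaOf Θ⟧ =ᵐ[P] fun ω =>
      (∏ j, (P⟦A j|sigmaOf Θ⟧) ω) * (P⟦E|sigmaOf Θ⟧) ω := by
    intro E hE
    have := h.condIndepIncrements (m + 1) (Fin.snoc e t) (strictMono_snoc he ht) Finset.univ
      (Fin.snoc A E) (fun i _ => ?_)
    · have hset : ⋂ i ∈ Finset.univ, (Fin.snoc A E : Fin (m + 1) → Set Ω) i = U ∩ E := by
        ext ω
        simp only [Finset.mem_univ, Set.iInter_true, Set.mem_iInter, Fin.forall_fin_succ',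
          Fin.snoc_castSucc (α := fun _ => Set Ω), Fin.snoc_last, Set.mem_inter_iff]
        simp [hA, hU, funext_iff, increments]
      rw [hset] at this
      simpa only [Fin.prod_univ_castSucc, Fin.snoc_castSucc (α := fun _ => Set Ω),
        Fin.snoc_last] using this
    · induction i using Fin.lastCases with
      | last =>
        rcases hE with rfl | rfl
        · refine ⟨{(n : ℝ)}, measurableSet_singleton _, ?_⟩
          rw [Fin.snoc_last, hD, hcast ht.le, Fin.succ_last, Fin.snoc_last,
            Fin.snoc_castSucc (α := fun _ => ℝ≥0)]
        · rw [Fin.snoc_last]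
          exact MeasurableSet.univ
      | cast j =>
        refine ⟨{(v j : ℝ)}, measurableSet_singleton _, ?_⟩
        rw [Fin.snoc_castSucc (α := fun _ => Set Ω), hA]
        dsimp only
        rw [hcast (he Fin.castSucc_lt_succ).le, Fin.succ_castSucc,
          Fin.snoc_castSucc (α := fun _ => ℝ≥0), Fin.snoc_castSucc (α := fun _ => ℝ≥0)]
  have huniv : P⟦(Set.univ : Set Ω)|sigmaOf Θ⟧ = fun _ => 1 := by
    rw [Set.indicator_univ]
    exact condExp_const hΘ.comap_le 1
  have hUi : Integrable (U.indicator fun _ => (1 : ℝ)) P := (integrable_const _).indicator hUm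
  have hUqi : Integrable ((fun ω => (q ω).toReal) * U.indicator fun _ => (1 : ℝ)) P :=
    hUi.bdd_mul (c := 1) hqm'.ennreal_toReal.aestronglyMeasurable
      (Filter.Eventually.of_forall hqb)
  have hpull := condExp_mul_of_stronglyMeasurable_left (μ := P) (m := sigmaOf Θ)
    (f := fun ω => (q ω).toReal) (g := U.indicator fun _ => (1 : ℝ))
    hqm.ennreal_toReal.stronglyMeasurable hUqi hUi
  have hUD : P⟦U ∩ D|sigmaOf Θ⟧ =ᵐ[P]
      P[(fun ω => (q ω).toReal) * U.indicator (fun _ => (1 : ℝ))|sigmaOf Θ] := by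
    have h2 := hind Set.univ (Or.inr rfl)
    rw [Set.inter_univ, huniv] at h2
    filter_upwards [hind D (Or.inl rfl), h2, hcD, hpull] with ω h1 h2 h3 h4
    rw [h1, h3, h4, Pi.mul_apply, h2]
    ring
  have key : ∫ ω in F, (P⟦U ∩ D|sigmaOf Θ⟧) ω ∂P = ∫ ω in F,
      (P[(fun ω => (q ω).toReal) * U.indicator (fun _ => (1 : ℝ))|sigmaOf Θ]) ω ∂P :=
    integral_congr_ae (ae_restrict_of_ae hUD)
  rw [setIntegral_condExp hΘ.comap_le ((integrable_const _).indicator (hUm.inter hDm)) hF,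
    setIntegral_condExp hΘ.comap_le hUqi hF, integral_indicator_const _ (hUm.inter hDm),
    measureReal_restrict_apply (hUm.inter hDm), smul_eq_mul, mul_one] at key
  have hr : ∫ ω in F, ((fun ω => (q ω).toReal) * U.indicator (fun _ => (1 : ℝ))) ω ∂P =
      (∫⁻ ω in F ∩ U, q ω ∂P).toReal := by
    rw [← integral_toReal hqm'.aemeasurable (Filter.Eventually.of_forall hqlt),
      Set.inter_comm, ← Measure.restrict_restrict hUm, ← integral_indicator hUm]
    refine integral_congr_ae (Filter.Eventually.of_forall fun ω => ?_)
    by_cases hω : ω ∈ U <;> simp [hω]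
  rw [hr] at key
  have hfin : ∫⁻ ω in F ∩ U, q ω ∂P ≠ ∞ :=
    ne_top_of_le_ne_top (measure_ne_top P (F ∩ U))
      ((lintegral_mono fun ω => hq1 ω).trans (by simp))
  rw [← ENNReal.toReal_eq_toReal_iff' (measure_ne_top _ _) hfin, ← key, measureReal_def,
    Set.inter_comm (U ∩ D) F, Set.inter_assoc]

/-- Every value of `N` on a grid starting at zero is a function of the increments. -/
lemma IsCountingProcess.measurable_comap_increments (hN : IsCountingProcess N) {m : ℕ}
    {e : Fin (m + 1) → ℝ≥0} (he : StrictMono e) (he0 : e 0 = 0) (i : Fin (m + 1)) :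
    Measurable[MeasurableSpace.comap (increments N e) ⊤] (N (e i)) := by
  have hmono := fun (j : Fin m) ω => hN.mono ω (he (Fin.castSucc_lt_succ (i := j))).le
  have h0 := hN.zero
  suffices ∃ φ : (Fin m → ℕ) → ℕ, N (e i) = φ ∘ increments N e by
    obtain ⟨φ, hφ⟩ := this
    rw [hφ]
    exact measurable_from_top.comp (comap_measurable _)
  induction i using Fin.induction with
  | zero => exact ⟨fun _ => 0, by funext ω; simp [he0, h0]⟩
  | succ j ih =>
    obtain ⟨φ, hφ⟩ := ih
    refine ⟨fun v => φ v + v j, funext fun ω => ?_⟩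
    have h1 := congrFun hφ ω
    have h2 : N (e j.castSucc) ω ≤ N (e j.succ) ω := hmono j ω
    simp only [Function.comp_apply] at h1 ⊢
    rw [← h1, increments]
    omega

lemma exists_grid (I : Finset ℝ≥0) {s : ℝ≥0} (hI : ∀ u ∈ I, u ≤ s) :
    ∃ (m : ℕ) (e : Fin (m + 1) → ℝ≥0), StrictMono e ∧ e 0 = 0 ∧ e (Fin.last m) = s ∧
      ∀ u ∈ I, ∃ i, e i = u := by
  classical
  -- Starting at `0`, where `N` vanishes, makes grid values sums of increments; ending at `s` lets
  -- the next increment start there.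
  set J : Finset ℝ≥0 := insert 0 (insert s I) with hJ
  have hcard : J.card = (J.card - 1) + 1 :=
    (Nat.sub_add_cancel (Finset.card_pos.2 ⟨0, Finset.mem_insert_self _ _⟩)).symm
  have hsurj : ∀ u ∈ J, ∃ i, J.orderEmbOfFin hcard i = u := fun u hu => by
    have : u ∈ Set.range (J.orderEmbOfFin hcard) := by
      rw [Finset.range_orderEmbOfFin]; exact hu
    exact this
  have hle : ∀ u ∈ J, u ≤ s := by
    intro u hu
    rcases Finset.mem_insert.1 hu with rfl | hu
    · exact zero_le
    rcases Finset.mem_insert.1 hu with rfl | hu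
    · exact le_rfl
    · exact hI u hu
  have hmono := (J.orderEmbOfFin hcard).strictMono
  refine ⟨J.card - 1, J.orderEmbOfFin hcard, hmono, ?_, ?_, fun u hu => ?_⟩
  · obtain ⟨i, hi⟩ := hsurj 0 (by simp [hJ])
    exact le_antisymm (hi ▸ hmono.monotone (Fin.zero_le i)) zero_le
  · obtain ⟨i, hi⟩ := hsurj s (by simp [hJ])
    refine le_antisymm (hle _ (Finset.orderEmbOfFin_mem J hcard _)) ?_
    conv_lhs => rw [← hi]
    exact hmono.monotone (Fin.le_last i)
  · exact hsurj u (by simp [hJ, hu])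

/-- The definition only concerns finitely many increments. The values of `N` up to `s` generate
their σ-algebra from events at finitely many times, and on a grid from `0` to `s` these are events
of the increments; uniqueness of measures gives the whole history. -/
lemma IsMPP.hasPoissonIncrements (h : IsMPP N Θ P) (hN : IsCountingProcess N)
    (hΘ : Measurable Θ) : HasPoissonIncrements N Θ P := by
  intro s t hst A hA n
  set D : Set Ω := {ω | N t ω - N s ω = n} with hD
  have hDm : MeasurableSet D := hN.measurable_sub s t (measurableSet_singleton n)
  set q : Ω → ℝ≥0∞ := fun ω => poissonMeasure ((t - s) * (Θ ω).toNNReal) {n} with hq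
  have hqm : Measurable q := measurable_poissonMeasure_param hΘ _ _
  have hNle : ⨆ u ∈ Set.Iic s, MeasurableSpace.comap (N u) inferInstance ≤ mΩ :=
    iSup₂_le fun u _ => (hN.measurable u).comap_le
  have hAm : MeasurableSet A := sup_le hNle hΘ.comap_le A hA
  have key := measure_eq_on_sup (μ := P.restrict D) (ν := P.withDensity q)
    (piiUnionInter (fun u => {E | MeasurableSet[MeasurableSpace.comap (N u) inferInstance] E})
      (Set.Iic s))
    (isPiSystem_piiUnionInter _ (fun u => @MeasurableSpace.isPiSystem_measurableSet _
      (MeasurableSpace.comap (N u) inferInstance)) _)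
    (generateFrom_piiUnionInter_measurableSet
      (fun u => MeasurableSpace.comap (N u) inferInstance) (Set.Iic s)).symm
    hNle hΘ.comap_le (fun F hF => ?_) ?_ hA
  · rwa [Measure.restrict_apply hAm, withDensity_apply _ hAm] at key
  · have hFm := hΘ.comap_le F hF
    rw [Measure.restrict_apply hFm, withDensity_apply _ hFm]
    exact h.measure_inter_sub hN hΘ hst n hF
  · rintro _ ⟨I, hI, f, hf, rfl⟩ F hF
    obtain ⟨m, e, he, he0, hes, heI⟩ := exists_grid I hI
    have hΔ : Measurable (increments N e) := measurable_increments fun j => hN.measurable _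
    obtain ⟨B, -, hB⟩ : MeasurableSet[MeasurableSpace.comap (increments N e) ⊤]
        (⋂ u ∈ I, f u) := by
      refine Finset.measurableSet_biInter I fun u hu => ?_
      obtain ⟨i, rfl⟩ := heI u hu
      exact (hN.measurable_comap_increments he he0 i).comap_le _ (hf _ hu)
    have hFm := hΘ.comap_le F hF
    -- Increment vectors take countably many values, so it suffices to compare their two laws at
    -- single points.
    have hlaw : (P.restrict (F ∩ D)).map (increments N e) =
        ((P.restrict F).withDensity q).map (increments N e) := by
      refine Measure.ext_of_singleton fun v => ?_
      have hv := hΔ (measurableSet_singleton v)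
      rw [Measure.map_apply hΔ (measurableSet_singleton v),
        Measure.map_apply hΔ (measurableSet_singleton v), Measure.restrict_apply hv,
        withDensity_apply _ hv, Measure.restrict_restrict hv, Set.inter_comm _ F,
        ← Set.inter_assoc, Set.inter_comm _ F]
      have := h.measure_inter_increments_eq hN hΘ he (hes.trans_lt hst) n hF v
      rw [hes] at this
      exact this
    have := congrArg (fun μ => μ B) hlaw
    have hBm := hΔ (MeasurableSet.of_discrete (s := B))
    simp only [Measure.map_apply hΔ (MeasurableSet.of_discrete (s := B))] at this
    rw [← hB, Measure.restrict_apply (hBm.inter hFm), withDensity_apply _ (hBm.inter hFm),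
      Set.inter_assoc, ← Measure.restrict_apply hBm, this, withDensity_apply _ hBm,
      Measure.restrict_restrict hBm]

/-- A counting process is mixed Poisson if and only if it has the intensity `Θ`. -/
lemma IsCountingProcess.isMPP_iff_hasIntensity (hN : IsCountingProcess N) (hΘ : Measurable Θ)
    (hΘ_int : Integrable Θ P) : IsMPP N Θ P ↔ HasIntensity N Θ P :=
  ⟨fun h => (h.hasPoissonIncrements hN hΘ).hasIntensity hN hΘ,
    fun h => (h.hasPoissonIncrements hN hΘ hΘ_int).isMPP hN hΘ⟩

/-- Since the aggregate process determines its counting process, being a compound mixed Poisson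
process is a property of the given counting process. -/
lemma IsRiskProcess.isCMPP_iff (hNX : IsRiskProcess N X P) :
    IsCMPP (aggregate N X) Θ (P.map (X 0)) P ↔ IsMPP N Θ P := by
  constructor
  · rintro ⟨N', X', hNX', hS, -, hmpp⟩
    rwa [hNX.counting.eq_of_aggregate_eq hNX'.counting hNX.size_pos hNX'.size_pos hS]
  · exact fun h => ⟨N, X, hNX, rfl, rfl, h⟩

end MixedPoisson

end CMPP

theorem theorem3p3 {Ω : Type*} [MeasurableSpace Ω] (P : Measure Ω) [IsProbabilityMeasure P]
    (N : ℝ≥0 → Ω → ℕ) (X : ℕ → Ω → ℝ) (Θ : Ω → ℝ)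
    (hNX : CMPP.IsRiskProcess N X P)
    (hΘ : Measurable Θ) (hΘ_pos : ∀ᵐ ω ∂P, 0 < Θ ω)
    (ha1 : CMPP.CondA1 N X Θ P) (ha2 : CMPP.CondA2 X Θ P)
    (hX_int : Integrable (X 0) P) (hΘ_int : Integrable Θ P) :
    CMPP.IsCMPP (CMPP.aggregate N X) Θ (P.map (X 0)) P ↔
      Martingale (fun (t : ℝ≥0) (ω : Ω) => CMPP.aggregate N X t ω - (t : ℝ) * Θ ω * ∫ ω', X 0 ω' ∂P)
        (CMPP.canonicalFiltration (CMPP.aggregate N X) Θ hNX.measurable_aggregate hΘ) P := by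
  rw [hNX.isCMPP_iff, hNX.counting.isMPP_iff_hasIntensity hΘ hΘ_int,
    hNX.hasIntensity_iff hΘ hΘ_int ha1 ha2 hX_int,
    hNX.martingale_iff hΘ hΘ_pos hΘ_int hX_int]
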